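/- **Setting.** For $x,v\in\mathbb R$ let $\Phi(v)=(1,v,\tfrac12v^2)^\top$. For a field $f(x,v)$ put $\mathbf U(f)=\int_{\mathbb R} f\,\Phi\,dv=(\rho,\rho u,E)^\top$, $E=\tfrac12(\rho u^2+\rho T)$, and $\mathbf F[f]=\int_{\mathbb R} f\,v\,\Phi\,dv$. Let $\mathcal M_{\mathbf U}(v)=\frac{\rho}{\sqrt{2\pi T}}e^{-(v-u)^2/(2T)}$ and let $\mathbf F_E(\mathbf U)=\int \mathcal M_{\mathbf U}\,v\,\Phi\,dv$ be the flux of the compressible Euler equations $\partial_t\mathbf U+\partial_x\mathbf F_E(\mathbf U)=0$. Norm: $\|f\|=\sup_{x,v}(1+|v|)^q|f(x,v)|$ with a fixed integer $q\ge5$. *Time discretization.* Let $(A,\mathbf b,\mathbf c)$ be an $s$-stage ($s\ge1$) stiffly accurate DIRK method: $A=(a_{k\ell})$ is invertible and lower triangular, $c_k=\sum_\ell a_{k\ell}$, and the last row of $A$ is $\mathbf b^\top$. Let it have order $p\in\{1,2,3\}$: $\sum b_i=1$; if $p\ge2$, $\sum b_ic_i=\frac12$; if $p=3$, $\sum b_ic_i^2=\frac13$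 and $\sum b_ia_{ij}c_j=\frac16$. *Low-rank scheme for the BGK equation* $f_t+vf_x=(\mathcal M_{\mathbf U(f)}-f)/\epsilon$, with step $\Delta t$ and exact evaluation at the feet of characteristics. Start from $\mathcal F^0=f_0^\epsilon$, $\mathbf U^0=\mathbf U(f_0^\epsilon)$. In each step, for $k=1,\dots,s$: 1. $\widetilde F^{(k)}(x,v)=\mathcal F^n(x-vc_k\Delta t,v)+\Delta t\sum_{\ell<k}a_{k\ell}\,\epsilon^{-1}\bigl(\mathcal M_{\mathbf U(\mathcal F^{(\ell)})}-\mathcal F^{(\ell)}\bigr)\bigl(x-v(c_k-c_\ell)\Delta t,v\bigr)$. It is compressed by a CUR decomposition (greedy adaptive cross approximation with pivots on a tensor-product mesh, tolerance $\varepsilon_c$ and a maximal rank) and then an SVD truncation (singular values below $\varepsilon_s$ of the matrix of mesh values are dropped). The result is $\widetilde{\mathcal F}^{(k)}$. Cross approximations and singular vectors are carried as functions of $x$ and $v$ (no interpolation error). 2. Put $\mathbf L_k(g)=\dfrac{\epsilon g+a_{kk}\Delta t\,\mathcal M_{\mathbf U(g)}}{\epsilon+a_{kk}\Delta t}$. The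 field $\mathbf L_k(\widetilde{\mathcal F}^{(k)})$ is compressed by CUR to $\mathcal F^{(k)}_{\{\#,k_2\}}$ and then by SVD truncation to $\mathcal F^{(k),\star}=\mathcal F^{(k)}_{\{\#,k_2\to r_2\}}$. 3. LoMaC correction: $\mathcal F^{(k)}=\mathcal F^{(k),\star}-\mathcal M_{\mathbf U(\mathcal F^{(k),\star})}+\mathcal M_{\mathbf U^{(k)}}$, where $\mathbf U^{(k)}=\mathbf U^n-\Delta t\sum_{\ell\le k}a_{k\ell}\,\partial_x\mathbf F[\mathcal F^{(\ell)}]$, the fluxes $\mathbf F[\mathcal F^{(\ell)}]$ being differentiable in $x$. Finally $\mathcal F^{n+1}=\mathcal F^{(s)}$, $\mathbf U^{n+1}=\mathbf U^{(s)}$. The truncation errors are $E_{\varepsilon_s}=\mathcal F^{(k)}_{\{\#,k_2\to r_2\}}-\mathcal F^{(k)}_{\{\#,k_2\}}$ and $E_{\varepsilon_c}=\mathcal F^{(k)}_{\{\#,k_2\}}-F^{(k)}$, where $F^{(k)}=\mathbf L_k(\widetilde F^{(k)})$ is the full-rank (uncompressed) stage value. **Hypotheses.** (i) The data $f_0^\epsilon$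 are measurable and well-prepared: $f_0^\epsilon=f_0+\epsilon f_1+\epsilon^2f_2+\cdots$ as an asymptotic expansion in $\|\cdot\|$, all $\|f_j\|<\infty$, and $f_0=\mathcal M_{\mathbf U(f_0)}$. (ii) For every $\Delta t\in(0,\tau]$ and all sufficiently small $\epsilon>0$ a run of the scheme with $N(\Delta t)$ steps is given; mesh, tolerances and maximal rank may depend on $\Delta t,\epsilon$. (iii) For each $\Delta t$, step and stage, as $\epsilon\to0$, the densities and temperatures of $\widetilde F^{(k)}$ and $\mathbf U^{(k)}$ are bounded below by positive constants and $\mathbf U^{(k)}$ is bounded, uniformly in $x$ and in small $\epsilon$. (iv) For each $\Delta t$, step and stage, $\|E_{\varepsilon_s}\|+\|E_{\varepsilon_c}\|=O(\epsilon)$ as $\epsilon\to0$. **Conclusion.** The low-rank scheme is asymptotically accurate of order $p$: (a) For each $\Delta t$, step and stage, $\|\mathcal F^{(k)}-\mathcal M_{\mathbf U(\mathcal F^{(k)})}\|=O(\epsilon)$ and $\sup_x|\mathbf F[\mathcal F^{(k)}]-\mathbf F_E(\mathbf U^{(k)})|=O(\epsilon)$ as $\epsilon\to0^+$. (b) Whenever,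 along some sequence (or filter) of $\epsilon\to0^+$, $\mathbf U^n\to\bar{\mathbf U}^n$ and $\mathbf U^{(k)}\to\bar{\mathbf U}^{(k)}$ uniformly for $k=1,\dots,s$, then along it $\|\mathcal F^{(k)}-\mathcal M_{\bar{\mathbf U}^{(k)}}\|\to0$, each $\mathbf F_E(\bar{\mathbf U}^{(k)})$ is differentiable in $x$, and the limits satisfy the DIRK discretization of the compressible Euler equations $\bar{\mathbf U}^{(k)}=\bar{\mathbf U}^n-\Delta t\sum_{\ell\le k}a_{k\ell}\,\partial_x\mathbf F_E(\bar{\mathbf U}^{(\ell)})$. (c) The temporal order is kept in the limit: for every $K>0$ there is $C$ such that for all $\Delta t\in(0,\tau]$, all steps $n$ and all limits as in (b) the following holds. Suppose the $\bar{\mathbf U}^{(k)}$ are of class $C^{p+1}$ with all derivatives up to order $p+1$ bounded by $K$ and with density and temperature $\ge1/K$, and suppose $\mathbf W$ is a $C^{p+1}$ function of $(t,x)$ that solves the compressible Euler equations on $[0,\Delta t]$ with $\mathbf W(0)=\bar{\mathbf U}^n$, and each $\mathbf W(t)$, $t\in[0,\Delta t]$, obeys the same bounds (in $x$). Then, eventually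 along the limit $\epsilon\to0$, $$\sup_x|\mathbf U^{n+1}-\mathbf W(\Delta t)|\le C\Delta t^{p+1},\qquad \|\mathcal F^{n+1}-\mathcal M_{\mathbf W(\Delta t)}\|\le C\Delta t^{p+1}.$$ -/

import Mathlib

open Filter Topology MeasureTheory
open scoped ENNReal

noncomputable section

namespace LowRankBGK

/-! ### Phase-space functions, moments, Maxwellians -/

/-- A distribution function `f x v`, with position `x` and velocity `v`. -/
abbrev Field := ℝ → ℝ → ℝ

/-- A macroscopic state `(ρ, ρ u, E)`. -/
abbrev State := Fin 3 → ℝ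

/-- The collision invariants `(1, v, v² / 2)`. -/
def collisionInvariant (v : ℝ) : State := ![1, v, v ^ 2 / 2]

/-- The moments `U(f) = ⟨f (1, v, v²/2)⟩_v`. -/
def moments (f : Field) (x : ℝ) : State :=
  fun i => ∫ v, f x v * collisionInvariant v i

/-- The macroscopic flux `⟨f (v, v², v³/2)⟩_v`. -/
def flux (f : Field) (x : ℝ) : State :=
  fun i => ∫ v, f x v * (v * collisionInvariant v i)

def density (U : State) : ℝ := U 0

def velocity (U : State) : ℝ := U 1 / U 0

/-- The temperature, determined by `E = (ρ u² + ρ T) / 2`. -/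
def temperature (U : State) : ℝ := 2 * U 2 / U 0 - velocity U ^ 2

/-- The Maxwellian with macroscopic state `U`. -/
def maxwellian (U : State) (v : ℝ) : ℝ :=
  density U / √(2 * Real.pi * temperature U) *
    Real.exp (-(v - velocity U) ^ 2 / (2 * temperature U))

/-- The local Maxwellian of a field of macroscopic states. -/
def localMaxwellian (U : ℝ → State) : Field := fun x v => maxwellian (U x) v

/-- The flux of the compressible Euler equations: the macroscopic flux closed by the Maxwellian. -/
def eulerFlux (U : State) : State :=
  fun i => ∫ v, maxwellian U v * (v * collisionInvariant v i)

/-- The weighted supremum norm `sup_{x,v} (1 + |v|)^q |f(x,v)|`, with values in `[0, ∞]`. -/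
def wnorm (q : ℕ) (f : Field) : ℝ≥0∞ :=
  ⨆ x : ℝ, ⨆ v : ℝ, ENNReal.ofReal ((1 + |v|) ^ q * |f x v|)

/-- Well-prepared initial data: an asymptotic expansion `f₀ + ε f₁ + ε² f₂ + ⋯` in powers of `ε`
whose leading term is a local Maxwellian. -/
def WellPrepared (q : ℕ) (f : ℝ → Field) : Prop :=
  ∃ g : ℕ → Field, (∀ j, wnorm q (g j) < ∞) ∧ g 0 = localMaxwellian (moments (g 0)) ∧
    ∀ m : ℕ, ∃ C : ℝ, ∀ᶠ ε in 𝓝[>] (0 : ℝ),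
      wnorm q (fun x v => f ε x v - ∑ j ∈ Finset.range (m + 1), ε ^ j * g j x v) ≤
        ENNReal.ofReal (C * ε ^ (m + 1))

/-! ### Diagonally implicit Runge-Kutta methods with `s = r + 1` stages -/

structure ButcherTableau (r : ℕ) where
  A : Matrix (Fin (r + 1)) (Fin (r + 1)) ℝ
  b : Fin (r + 1) → ℝ
  c : Fin (r + 1) → ℝ

/-- A stiffly accurate DIRK method: `A` is invertible and lower triangular, the nodes `c` are the
row sums of `A`, and the last row of `A` is `b`. -/
structure ButcherTableau.IsStifflyAccurateDIRK {r : ℕ} (T : ButcherTableau r) : Prop where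
  lower : ∀ i j, i < j → T.A i j = 0
  invertible : IsUnit T.A.det
  row_sum : ∀ i, T.c i = ∑ j, T.A i j
  stiffly_accurate : ∀ j, T.A (Fin.last r) j = T.b j

/-- The order conditions of a Runge-Kutta method, for orders `p ≤ 3`. -/
structure ButcherTableau.HasOrder {r : ℕ} (T : ButcherTableau r) (p : ℕ) : Prop where
  le_three : p ≤ 3
  first : 1 ≤ p → ∑ i, T.b i = 1
  second : 2 ≤ p → ∑ i, T.b i * T.c i = 1 / 2
  third : 3 ≤ p → ∑ i, T.b i * T.c i ^ 2 = 1 / 3 ∧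
    ∑ i, ∑ j, T.b i * T.A i j * T.c j = 1 / 6

/-! ### Adaptive cross approximation and singular value truncation on a tensor-product mesh -/

/-- The mesh points and the parameters of the compression: the sampling tolerance `epsC`, the
maximal rank, and the singular value tolerance `epsS`. -/
structure Compression where
  Nx : ℕ
  Nv : ℕ
  xs : Fin Nx → ℝ
  vs : Fin Nv → ℝ
  epsC : ℝ
  epsS : ℝ
  maxRank : ℕ

/-- The Frobenius norm of the matrix of mesh values. -/
def Compression.frobenius (P : Compression) (f : Field) : ℝ :=
  √(∑ i, ∑ j, f (P.xs i) (P.vs j) ^ 2)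

/-- The rank-one field `R(x, v_j) R(x_i, v) / R(x_i, v_j)`. -/
def Compression.cross (P : Compression) (R : Field) (i : Fin P.Nx) (j : Fin P.Nv) : Field :=
  fun x v => (R (P.xs i) (P.vs j))⁻¹ * (R x (P.vs j) * R (P.xs i) v)

/-- `P.ACASteps A k I J B δ`: after `k` steps, the greedy cross approximation of `A` has selected the
mesh rows `I` and the mesh columns `J`, its current value is `B`, and `δ` is the Frobenius norm of
the most recent correction (`⊤` before the first step). The candidates of every step are twelve
arbitrary pairs of unselected indices. All fields are functions on the phase space; on the mesh
points the recursion is the one for matrices. -/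
inductive Compression.ACASteps (P : Compression) (A : Field) :
    ℕ → Finset (Fin P.Nx) → Finset (Fin P.Nv) → Field → EReal → Prop
  | zero : Compression.ACASteps P A 0 ∅ ∅ (fun _ _ => 0) ⊤
  | step (k : ℕ) (I : Finset (Fin P.Nx)) (J : Finset (Fin P.Nv)) (B R : Field) (δ : EReal)
      (prev : Compression.ACASteps P A k I J B δ)
      (more : (P.epsC : EReal) ≤ δ) (room : k < P.maxRank)
      (residual : R = fun x v => A x v - B x v)
      (cand : Fin 12 → Fin P.Nx × Fin P.Nv)
      (unselected : ∀ m, (cand m).1 ∉ I ∧ (cand m).2 ∉ J)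
      (best : Fin 12)
      (best_max : ∀ m, |R (P.xs (cand m).1) (P.vs (cand m).2)| ≤
        |R (P.xs (cand best).1) (P.vs (cand best).2)|)
      (i : Fin P.Nx)
      (row_max : ∀ i', |R (P.xs i') (P.vs (cand best).2)| ≤
        |R (P.xs i) (P.vs (cand best).2)|)
      (j : Fin P.Nv)
      (col_max : ∀ j', |R (P.xs i) (P.vs j')| ≤ |R (P.xs i) (P.vs j)|)
      (pivot : R (P.xs i) (P.vs j) ≠ 0) :
      Compression.ACASteps P A (k + 1) (insert i I) (insert j J)
        (fun x v => B x v + P.cross R i j x v) (P.frobenius (P.cross R i j) : EReal)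

/-- `B` is an output of the cross approximation (CUR decomposition) of `A`: the iteration stops when
the last correction is below the tolerance, the maximal rank is reached, or the residual vanishes
on the mesh. -/
def Compression.IsCUR (P : Compression) (A B : Field) : Prop :=
  ∃ k I J δ, P.ACASteps A k I J B δ ∧
    (δ < (P.epsC : EReal) ∨ k = P.maxRank ∨
      ∀ i j, A (P.xs i) (P.vs j) = B (P.xs i) (P.vs j))

/-- `B` is the singular value truncation of the finite-rank field `A`: the singular vectors are
orthonormal on the mesh, and the singular values below `epsS` are dropped. -/
def Compression.IsSVDTruncation (P : Compression) (A B : Field) : Prop :=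
  ∃ (m : ℕ) (σ : Fin m → ℝ) (u w : Fin m → ℝ → ℝ),
    (∀ a, 0 < σ a) ∧ Antitone σ ∧
    (∀ a a', ∑ i, u a (P.xs i) * u a' (P.xs i) = if a = a' then 1 else 0) ∧
    (∀ a a', ∑ j, w a (P.vs j) * w a' (P.vs j) = if a = a' then 1 else 0) ∧
    (∀ x v, A x v = ∑ a, σ a * u a x * w a v) ∧
    (∀ x v, B x v = ∑ a, if P.epsS ≤ σ a then σ a * u a x * w a v else 0)

/-! ### The low-rank scheme -/

/-- The semi-Lagrangian part of stage `k`, with exact evaluation at the feet of the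
characteristics: `f` is the solution at the old time level and `g l` are the earlier stages. -/
def slUpdate {r : ℕ} (T : ButcherTableau r) (Δt ε : ℝ) (f : Field) (g : Fin (r + 1) → Field)
    (k : Fin (r + 1)) : Field :=
  fun x v => f (x - v * (T.c k * Δt)) v +
    Δt * ∑ l ∈ Finset.Iio k, T.A k l *
      ((localMaxwellian (moments (g l)) (x - v * ((T.c k - T.c l) * Δt)) v
        - g l (x - v * ((T.c k - T.c l) * Δt)) v) / ε)

/-- The explicit form of the implicit collision update, with diagonal coefficient `a`. -/
def collisionUpdate (a Δt ε : ℝ) (f : Field) : Field :=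
  fun x v => (ε * f x v + a * Δt * localMaxwellian (moments f) x v) / (ε + a * Δt)

/-- All quantities that the scheme computes; step `n` leads from time level `n` to `n + 1`. -/
structure Trajectory (r : ℕ) where
  /-- the kinetic solution at time level `n` -/
  kin : ℕ → Field
  /-- the macroscopic solution at time level `n` -/
  mac : ℕ → ℝ → State
  /-- the CUR decomposition of the semi-Lagrangian update -/
  slCUR : ℕ → Fin (r + 1) → Field
  /-- its SVD truncation -/
  slSVD : ℕ → Fin (r + 1) → Field
  /-- the CUR decomposition of the collision update -/
  starCUR : ℕ → Fin (r + 1) → Field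
  /-- its SVD truncation: the provisional kinetic stage value -/
  starSVD : ℕ → Fin (r + 1) → Field
  /-- the corrected (conservative) kinetic stage value -/
  stageKin : ℕ → Fin (r + 1) → Field
  /-- the macroscopic stage value -/
  stageMac : ℕ → Fin (r + 1) → ℝ → State

variable {r : ℕ}

/-- The full-rank semi-Lagrangian update of stage `k` of step `n`. -/
def Trajectory.fullSL (R : Trajectory r) (T : ButcherTableau r) (Δt ε : ℝ) (n : ℕ)
    (k : Fin (r + 1)) : Field :=
  slUpdate T Δt ε (R.kin n) (R.stageKin n) k

/-- The full-rank (uncompressed) kinetic solution of stage `k` of step `n`, computed by the local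
semi-Lagrangian solver from the available solutions. -/
def Trajectory.fullStage (R : Trajectory r) (T : ButcherTableau r) (Δt ε : ℝ) (n : ℕ)
    (k : Fin (r + 1)) : Field :=
  collisionUpdate (T.A k k) Δt ε (R.fullSL T Δt ε n k)

/-- The SVD truncation error of stage `k` of step `n`. -/
def Trajectory.errSVD (R : Trajectory r) (n : ℕ) (k : Fin (r + 1)) : Field :=
  fun x v => R.starSVD n k x v - R.starCUR n k x v

/-- The CUR truncation error of stage `k` of step `n`. -/
def Trajectory.errCUR (R : Trajectory r) (T : ButcherTableau r) (Δt ε : ℝ) (n : ℕ)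
    (k : Fin (r + 1)) : Field :=
  fun x v => R.starCUR n k x v - R.fullStage T Δt ε n k x v

/-- `R` is a run of `N` steps of the low-rank scheme with initial data `f`. -/
structure Trajectory.IsRun (R : Trajectory r) (T : ButcherTableau r) (P : Compression)
    (Δt ε : ℝ) (N : ℕ) (f : Field) : Prop where
  kin_zero : R.kin 0 = f
  mac_zero : R.mac 0 = moments f
  slCUR_spec : ∀ n < N, ∀ k, P.IsCUR (R.fullSL T Δt ε n k) (R.slCUR n k)
  slSVD_spec : ∀ n < N, ∀ k, P.IsSVDTruncation (R.slCUR n k) (R.slSVD n k)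
  starCUR_spec : ∀ n < N, ∀ k,
    P.IsCUR (collisionUpdate (T.A k k) Δt ε (R.slSVD n k)) (R.starCUR n k)
  starSVD_spec : ∀ n < N, ∀ k, P.IsSVDTruncation (R.starCUR n k) (R.starSVD n k)
  correction : ∀ n < N, ∀ k x v, R.stageKin n k x v =
    R.starSVD n k x v - localMaxwellian (moments (R.starSVD n k)) x v
      + localMaxwellian (R.stageMac n k) x v
  flux_differentiable : ∀ n < N, ∀ k, Differentiable ℝ (flux (R.stageKin n k))
  macroscopic : ∀ n < N, ∀ k x, R.stageMac n k x =
    R.mac n x - Δt • ∑ l ∈ Finset.Iic k, T.A k l • deriv (flux (R.stageKin n l)) x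
  kin_succ : ∀ n < N, R.kin (n + 1) = R.stageKin n (Fin.last r)
  mac_succ : ∀ n < N, R.mac (n + 1) = R.stageMac n (Fin.last r)

/-! ### Asymptotic accuracy -/

/-- `U` is of class `C^m` with all derivatives up to order `m` bounded by `K`, and its density and
temperature are at least `1 / K`. -/
structure SmoothState (m : ℕ) (K : ℝ) (U : ℝ → State) : Prop where
  contDiff : ContDiff ℝ m U
  bound : ∀ j ≤ m, ∀ x, ‖iteratedDeriv j U x‖ ≤ K
  density_ge : ∀ x, K⁻¹ ≤ density (U x)
  temperature_ge : ∀ x, K⁻¹ ≤ temperature (U x)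

/-- `W` is an exact solution, on the time interval `[0, Δt]`, of the compressible Euler equations
`∂ₜ W + ∂ₓ F(W) = 0`, of class `C^m` and with the bounds of `SmoothState m K`. -/
structure IsSmoothEulerSolution (m : ℕ) (K Δt : ℝ) (W : ℝ → ℝ → State) : Prop where
  contDiff : ContDiff ℝ m (fun z : ℝ × ℝ => W z.1 z.2)
  smooth : ∀ t ∈ Set.Icc 0 Δt, SmoothState m K (W t)
  euler : ∀ t ∈ Set.Icc 0 Δt, ∀ x,
    HasDerivAt (fun t' => W t' x) (-deriv (fun y => eulerFlux (W t y)) x) t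

/-- `U₀` and `U k` are the limits, along the filter `L` of Knudsen numbers, of the macroscopic
solution at time level `n` and of the macroscopic stage values of step `n`. -/
def IsMacroLimit (R : ℝ → Trajectory r) (n : ℕ) (L : Filter ℝ)
    (U₀ : ℝ → State) (U : Fin (r + 1) → ℝ → State) : Prop :=
  TendstoUniformly (fun ε => (R ε).mac n) U₀ L ∧
    ∀ k, TendstoUniformly (fun ε => (R ε).stageMac n k) (U k) L

/-- Asymptotic accuracy of order `p` of the runs `R Δt ε` (`0 < Δt ≤ τ`, with `N Δt` steps) as
`ε → 0`. -/
structure IsAsymptoticallyAccurate (q : ℕ) (T : ButcherTableau r) (p : ℕ) (τ : ℝ) (N : ℝ → ℕ)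
    (R : ℝ → ℝ → Trajectory r) : Prop where
  /-- Every stage is `O(ε)`-close to its local Maxwellian. -/
  near_equilibrium : ∀ Δt ∈ Set.Ioc 0 τ, ∀ n < N Δt, ∀ k, ∃ C : ℝ, ∀ᶠ ε in 𝓝[>] (0 : ℝ),
    wnorm q (fun x v => (R Δt ε).stageKin n k x v
      - localMaxwellian (moments ((R Δt ε).stageKin n k)) x v) ≤ ENNReal.ofReal (C * ε)
  /-- The macroscopic flux of every stage is `O(ε)`-close to the Euler flux. -/
  euler_closure : ∀ Δt ∈ Set.Ioc 0 τ, ∀ n < N Δt, ∀ k, ∃ C : ℝ, ∀ᶠ ε in 𝓝[>] (0 : ℝ),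
    ∀ x, ‖flux ((R Δt ε).stageKin n k) x - eulerFlux ((R Δt ε).stageMac n k x)‖ ≤ C * ε
  /-- As `ε → 0`, the kinetic stages tend to the Maxwellians of the limiting macroscopic stages, and
  these satisfy the DIRK discretization of the compressible Euler equations. -/
  limit_scheme : ∀ Δt ∈ Set.Ioc 0 τ, ∀ n < N Δt, ∀ (L : Filter ℝ), L.NeBot → L ≤ 𝓝[>] 0 →
    ∀ (U₀ : ℝ → State) (U : Fin (r + 1) → ℝ → State), IsMacroLimit (R Δt) n L U₀ U →
    ∀ k,
      Tendsto (fun ε => wnorm q (fun x v => (R Δt ε).stageKin n k x v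
        - localMaxwellian (U k) x v)) L (𝓝 0) ∧
      Differentiable ℝ (fun x => eulerFlux (U k x)) ∧
      ∀ x, U k x = U₀ x -
        Δt • ∑ l ∈ Finset.Iic k, T.A k l • deriv (fun y => eulerFlux (U l y)) x
  /-- In the limit `ε → 0` the scheme keeps its order `p` of temporal accuracy: one step differs by
  `O(Δt^(p+1))` from the exact solution of the compressible Euler equations, with a constant that
  depends on `Δt`, `n` and the limit only through the smoothness bound `K`. -/
  order_of_accuracy : ∀ K > 0, ∃ C : ℝ, ∀ Δt ∈ Set.Ioc 0 τ, ∀ n < N Δt,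
    ∀ (L : Filter ℝ), L.NeBot → L ≤ 𝓝[>] 0 →
    ∀ (U₀ : ℝ → State) (U : Fin (r + 1) → ℝ → State), IsMacroLimit (R Δt) n L U₀ U →
    (∀ k, SmoothState (p + 1) K (U k)) →
    ∀ W : ℝ → ℝ → State, IsSmoothEulerSolution (p + 1) K Δt W → W 0 = U₀ →
      ∀ᶠ ε in L,
        (∀ x, ‖(R Δt ε).mac (n + 1) x - W Δt x‖ ≤ C * Δt ^ (p + 1)) ∧
        wnorm q (fun x v => (R Δt ε).kin (n + 1) x v - localMaxwellian (W Δt) x v) ≤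
          ENNReal.ofReal (C * Δt ^ (p + 1))

/-- Density and temperature are bounded below by positive constants, uniformly for small `ε`. -/
def NonDegenerate (U : ℝ → ℝ → State) : Prop :=
  ∃ ρm > 0, ∃ Tm > 0, ∀ᶠ ε in 𝓝[>] (0 : ℝ), ∀ x,
    ρm ≤ density (U ε x) ∧ Tm ≤ temperature (U ε x)

/-- Uniform boundedness for small `ε`. -/
def UniformlyBounded (U : ℝ → ℝ → State) : Prop :=
  ∃ K : ℝ, ∀ᶠ ε in 𝓝[>] (0 : ℝ), ∀ x, ‖U ε x‖ ≤ K

end LowRankBGK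

end

/-! Closeness to equilibrium. The implicit collision step satisfies the identity `L_k(g) - M_{U(g)}
= ε / (ε + a_kk Δt) * (g - M_{U(g)})`, and `a_kk ≠ 0` because `A` is triangular and invertible. So a
bounded `g` lands within `O(ε)` of its Maxwellian, provided its moments stay in a compact set of
admissible states, on which `U ↦ M_U` is Lipschitz in the weighted norm. Boundedness of `g` follows
by induction over the stages: the stiff terms `(M - F) / ε` of earlier stages are bounded once those
stages are `O(ε)`-close to equilibrium. The assumed `O(ε)` compression errors do no harm, and the
LoMaC correction makes `F^(k) - M_{U^(k)}` equal to `F^* - M_{U(F^*)}`, which is `O(ε)`. The fluxes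
are therefore Euler fluxes up to `O(ε)`. See `collisionUpdate_near_equilibrium`,
`UniformlyAdmissible.closure`, `AdmissibleRuns.near_maxwellian`.

Limit scheme. Convergence of the fluxes does not by itself give convergence of their derivatives.
But since `A` is invertible, the flux derivatives are fixed linear combinations of `(U^n - U^(k)) /
Δt`, which converge uniformly; this allows limit and derivative to be exchanged
(`AdmissibleRuns.limit_scheme`).

Order. The limit stages and the exact Euler solution both solve `y = y₀ - h ∫ ∂ₓF(y)`, with a
Runge-Kutta quadrature in one case and the time integral in the other. Picard iteration gains one
power of `h` and loses one space derivative per round, so `p + 1` bounded derivatives suffice for an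
expansion with remainder `O(h^(p+1))` (`Integrates.expansion`). Its coefficient functions depend
only on `y₀`, the same for both problems. In the difference only the quadrature coefficients remain,
and the order conditions match them (`local_error`). All estimates are made for families with one
constant per family, which gives uniformity in `Δt`, in the step and in the limit. -/

noncomputable section

namespace LowRankBGK

/-! ### Maxwellians -/

/-- The states of positive density and temperature. -/
def admissible : Set State := {U | 0 < density U ∧ 0 < temperature U}

open ProbabilityTheory in
theorem maxwellian_eq_gaussianPDFReal {U : State} (hT : 0 < temperature U) (v : ℝ) :
    maxwellian U v =
      density U * gaussianPDFReal (velocity U) (temperature U).toNNReal v := by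
  simp only [maxwellian, gaussianPDFReal, Real.coe_toNNReal _ hT.le]
  ring

open ProbabilityTheory in
theorem integral_maxwellian_mul {U : State} (hT : 0 < temperature U) (φ : ℝ → ℝ) :
    ∫ v, maxwellian U v * φ v =
      density U * ∫ v, φ v ∂gaussianReal (velocity U) (temperature U).toNNReal := by
  rw [integral_gaussianReal_eq_integral_smul (by simpa using hT), ← integral_const_mul]
  simp only [maxwellian_eq_gaussianPDFReal hT, smul_eq_mul, mul_assoc]

open ProbabilityTheory in
theorem integrable_pow_gaussianReal (μ : ℝ) (v : NNReal) (n : ℕ) :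
    Integrable (fun x : ℝ => x ^ n) (gaussianReal μ v) := by
  have h := (memLp_id_gaussianReal (μ := μ) (v := v) n).integrable_norm_pow'
  refine h.mono' (by fun_prop) (Eventually.of_forall fun x => ?_)
  simp

open ProbabilityTheory in
theorem integral_sq_gaussianReal (μ : ℝ) (v : NNReal) :
    ∫ x, x ^ 2 ∂gaussianReal μ v = v + μ ^ 2 := by
  have h := variance_eq_sub (memLp_id_gaussianReal (μ := μ) (v := v) 2)
  simp only [variance_id_gaussianReal, id, Pi.pow_apply, integral_id_gaussianReal] at h
  linarith

-- The reflection `x ↦ 2μ - x` preserves the Gaussian; expanding the reflected cube gives a linear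
-- equation for the third moment.
open ProbabilityTheory in
theorem integral_cube_gaussianReal (μ : ℝ) (v : NNReal) :
    ∫ x, x ^ 3 ∂gaussianReal μ v = μ ^ 3 + 3 * μ * v := by
  have hi := integrable_pow_gaussianReal μ v
  have hmap : (gaussianReal μ v).map (fun x => 2 * μ - x) = gaussianReal μ v := by
    rw [gaussianReal_map_const_sub]; congr 1; ring
  have h1 : ∫ x, x ^ 3 ∂gaussianReal μ v = ∫ x, (2 * μ - x) ^ 3 ∂gaussianReal μ v := by
    conv_lhs => rw [← hmap]
    rw [integral_map (by fun_prop) (by fun_prop)]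
  have h2 : ∀ x : ℝ, (2 * μ - x) ^ 3 =
      8 * μ ^ 3 - 12 * μ ^ 2 * x + 6 * μ * x ^ 2 - x ^ 3 := fun x => by ring
  simp_rw [h2] at h1
  have i1 : Integrable (fun x : ℝ => 12 * μ ^ 2 * x) (gaussianReal μ v) := by
    simpa using (hi 1).const_mul (12 * μ ^ 2)
  have i2 := (hi 2).const_mul (6 * μ)
  have i3 : Integrable (fun x : ℝ => 8 * μ ^ 3 - 12 * μ ^ 2 * x) (gaussianReal μ v) :=
    (integrable_const _).sub i1
  have i4 : Integrable (fun x : ℝ => 8 * μ ^ 3 - 12 * μ ^ 2 * x + 6 * μ * x ^ 2)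
    (gaussianReal μ v) := i3.add i2
  rw [integral_sub i4 (hi 3), integral_add i3 i2, integral_sub (integrable_const _) i1] at h1
  have h3 : ∫ x, 12 * μ ^ 2 * x ∂gaussianReal μ v = 12 * μ ^ 2 * μ := by
    rw [integral_const_mul, integral_id_gaussianReal]
  rw [h3, integral_const_mul (6 * μ), integral_sq_gaussianReal] at h1
  simp at h1
  linarith

theorem moments_maxwellian {U : State} (hU : U ∈ admissible) (i : Fin 3) :
    ∫ v, maxwellian U v * collisionInvariant v i = U i := by
  obtain ⟨hρ, hT⟩ := hU
  have hρ' : U 0 ≠ 0 := hρ.ne'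
  have hc : ((temperature U).toNNReal : ℝ) = temperature U := Real.coe_toNNReal _ hT.le
  fin_cases i
  · simp only [collisionInvariant]
    simpa [density] using integral_maxwellian_mul hT (fun _ => 1)
  · simp only [collisionInvariant]
    refine (integral_maxwellian_mul hT (fun v => v)).trans ?_
    rw [ProbabilityTheory.integral_id_gaussianReal]
    simp [density, velocity, mul_div_cancel₀, hρ']
  · simp only [collisionInvariant]
    refine (integral_maxwellian_mul hT (fun v => v ^ 2 / 2)).trans ?_
    rw [integral_div, integral_sq_gaussianReal, hc]
    simp [density, velocity, temperature]; field_simp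

theorem moments_localMaxwellian {U : ℝ → State} {x : ℝ} (hU : U x ∈ admissible) :
    moments (localMaxwellian U) x = U x :=
  funext fun i => moments_maxwellian hU i

/-- The explicit Euler flux. -/
theorem eulerFlux_eq {U : State} (hU : U ∈ admissible) :
    eulerFlux U = ![U 1, 2 * U 2, 3 * U 1 * U 2 * (U 0)⁻¹ - U 1 ^ 3 * (U 0)⁻¹ ^ 2] := by
  obtain ⟨hρ, hT⟩ := hU
  have hρ' : U 0 ≠ 0 := hρ.ne'
  have hc : ((temperature U).toNNReal : ℝ) = temperature U := Real.coe_toNNReal _ hT.le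
  funext i
  fin_cases i
  · simp only [eulerFlux, collisionInvariant]
    refine (integral_maxwellian_mul hT (fun v => v * 1)).trans ?_
    simp only [mul_one, ProbabilityTheory.integral_id_gaussianReal]
    simp [density, velocity, mul_div_cancel₀, hρ']
  · simp only [eulerFlux, collisionInvariant]
    refine (integral_maxwellian_mul hT (fun v => v * v)).trans ?_
    simp only [← sq, integral_sq_gaussianReal, hc]
    simp [density, velocity, temperature]; field_simp
  · simp only [eulerFlux, collisionInvariant]
    refine (integral_maxwellian_mul hT (fun v => v * (v ^ 2 / 2))).trans ?_
    have : ∀ v : ℝ, v * (v ^ 2 / 2) = v ^ 3 / 2 := fun v => by ring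
    simp only [this, integral_div, integral_cube_gaussianReal, hc]
    simp [density, velocity, temperature]; field_simp; ring

/-! ### Compact sets of admissible states and Lipschitz dependence of the Maxwellian -/

theorem isOpen_admissible : IsOpen admissible := by
  have h0 : IsOpen {U : State | 0 < U 0} := isOpen_lt continuous_const (continuous_apply 0)
  have hc : ContinuousOn temperature {U : State | 0 < U 0} := by
    have : ∀ U ∈ {U : State | 0 < U 0}, U 0 ≠ 0 := fun U hU => ne_of_gt hU
    unfold temperature velocity
    fun_prop (disch := assumption)
  exact hc.isOpen_inter_preimage h0 isOpen_Ioi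

/-- Admissible states with quantitative bounds. -/
def boundedStates (ρm Tm K : ℝ) : Set State :=
  {U | ρm ≤ density U ∧ Tm ≤ temperature U ∧ ‖U‖ ≤ K}

theorem boundedStates_subset {ρm Tm K : ℝ} (hρ : 0 < ρm) (hT : 0 < Tm) :
    boundedStates ρm Tm K ⊆ admissible :=
  fun _ hU => ⟨hρ.trans_le hU.1, hT.trans_le hU.2.1⟩

/-- The lower density bound keeps away from vacuum, where `temperature` is not continuous, so the
temperature constraint is closed. -/
theorem isCompact_boundedStates {ρm : ℝ} (hρ : 0 < ρm) (Tm K : ℝ) :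
    IsCompact (boundedStates ρm Tm K) := by
  have hc : ContinuousOn temperature {U : State | ρm ≤ U 0} := by
    have : ∀ U ∈ {U : State | ρm ≤ U 0}, U 0 ≠ 0 := fun U hU => (hρ.trans_le hU).ne'
    unfold temperature velocity
    fun_prop (disch := assumption)
  have h1 : IsClosed ({U : State | ρm ≤ U 0} ∩ temperature ⁻¹' Set.Ici Tm) :=
    hc.preimage_isClosed_of_isClosed (isClosed_le continuous_const (continuous_apply 0))
      isClosed_Ici
  refine ((isCompact_closedBall (0 : State) K).inter_right h1).of_isClosed_subset ?_ ?_
  · have : boundedStates ρm Tm K = ({U : State | ρm ≤ U 0} ∩ temperature ⁻¹' Set.Ici Tm) ∩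
        Metric.closedBall 0 K := by
      ext U; simp [boundedStates, density, and_assoc]
    rw [this]
    exact h1.inter Metric.isClosed_closedBall
  · intro U hU
    exact ⟨by simpa using hU.2.2, hU.1, hU.2.1⟩

/-- `S` need not be convex, so no mean value inequality is applied on it; local Lipschitz continuity
on a compact set gives the global one. -/
theorem exists_lipschitz_of_contDiffOn {S : Set State} (hS : IsCompact S) {Ω : Set State}
    (hΩ : IsOpen Ω) (hSΩ : S ⊆ Ω) {g : State → ℝ} (hg : ContDiffOn ℝ 1 g Ω) :
    ∃ C, 0 ≤ C ∧ (∀ U ∈ S, |g U| ≤ C) ∧ ∀ U ∈ S, ∀ V ∈ S, |g U - g V| ≤ C * ‖U - V‖ := by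
  have hl : LocallyLipschitzOn S g := by
    intro U hU
    obtain ⟨K, t, ht, hK⟩ :=
      ((hg.contDiffAt (hΩ.mem_nhds (hSΩ hU))).exists_lipschitzOnWith)
    exact ⟨K, t, nhdsWithin_le_nhds ht, hK⟩
  obtain ⟨K, hK⟩ := hl.exists_lipschitzOnWith_of_compact hS
  obtain ⟨B, hB⟩ := hS.exists_bound_of_continuousOn (hg.continuousOn.mono hSΩ)
  refine ⟨max K B, le_max_of_le_left K.2, fun U hU => (hB U hU).trans (le_max_right _ _),
    fun U hU V hV => ?_⟩
  have := hK.dist_le_mul U hU V hV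
  rw [Real.dist_eq, dist_eq_norm] at this
  exact this.trans (by gcongr; exact le_max_left _ _)

theorem abs_exp_sub_exp_le (a b : ℝ) :
    |Real.exp a - Real.exp b| ≤ |a - b| * (Real.exp a + Real.exp b) := by
  wlog h : b ≤ a generalizing a b
  · rw [abs_sub_comm, abs_sub_comm a, add_comm]
    exact this b a (le_of_not_ge h)
  rw [abs_of_nonneg (sub_nonneg.2 (Real.exp_le_exp.2 h)), abs_of_nonneg (sub_nonneg.2 h)]
  have h1 : Real.exp b = Real.exp a * Real.exp (b - a) := by rw [← Real.exp_add]; ring_nf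
  have h2 := Real.add_one_le_exp (b - a)
  have h3 := Real.exp_pos a
  nlinarith [Real.exp_pos b, mul_nonneg (sub_nonneg.2 h) (Real.exp_pos b).le]

theorem exists_pow_mul_exp_le (n : ℕ) (A B g : ℝ) (hg : 0 < g) :
    ∃ C, ∀ v : ℝ, (1 + |v|) ^ n * Real.exp (A + B * |v| - g * v ^ 2) ≤ C := by
  -- complete the square: `B |v| - g v² ≤ (B + n)² / (4 g) - n |v|`
  refine ⟨Real.exp (A + (B + n) ^ 2 / (4 * g)), fun v => ?_⟩
  have h1 : (1 + |v|) ^ n ≤ Real.exp (n * |v|) := by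
    rw [Real.exp_nat_mul]
    exact pow_le_pow_left₀ (by positivity) (by linarith [Real.add_one_le_exp |v|]) n
  refine (mul_le_mul_of_nonneg_right h1 (Real.exp_pos _).le).trans ?_
  rw [← Real.exp_add, Real.exp_le_exp]
  have h2 : (B + n) ^ 2 / (4 * g) - ((B + n) * |v| - g * v ^ 2) =
      ((B + n) - 2 * g * |v|) ^ 2 / (4 * g) := by
    field_simp; rw [← sq_abs v]; ring
  have h3 : 0 ≤ ((B + n) - 2 * g * |v|) ^ 2 / (4 * g) := by positivity
  linarith

/-- The exponent is a quadratic polynomial in `v` whose coefficients are smooth in `U`. Bounds for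
the Maxwellian thereby reduce to bounds for three functions of `U`. -/
theorem maxwellian_eq_exp {U : State} (hU : U ∈ admissible) (v : ℝ) :
    maxwellian U v = Real.exp
      ((Real.log (density U / √(2 * Real.pi * temperature U)) -
        velocity U ^ 2 / (2 * temperature U)) + velocity U / temperature U * v
        - 1 / (2 * temperature U) * v ^ 2) := by
  obtain ⟨hρ, hT⟩ := hU
  have h : 0 < density U / √(2 * Real.pi * temperature U) := by positivity
  rw [maxwellian]
  conv_lhs => rw [← Real.exp_log h]
  rw [← Real.exp_add]
  congr 1
  field_simp
  ring

/-- Boundedness and Lipschitz continuity of `U ↦ M_U` in the weighted norm. -/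
theorem exists_maxwellian_bounds {S : Set State} (hS : IsCompact S) (hSΩ : S ⊆ admissible)
    (q : ℕ) : ∃ C, 0 ≤ C ∧ (∀ U ∈ S, ∀ v, (1 + |v|) ^ q * |maxwellian U v| ≤ C) ∧
      ∀ U ∈ S, ∀ V ∈ S, ∀ v,
        (1 + |v|) ^ q * |maxwellian U v - maxwellian V v| ≤ C * ‖U - V‖ := by
  have hρ : ∀ U ∈ admissible, U 0 ≠ 0 := fun U hU => ne_of_gt hU.1
  have hT : ∀ U ∈ admissible, temperature U ≠ 0 := fun U hU => ne_of_gt hU.2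
  have cρ : ContDiffOn ℝ 1 density admissible := by unfold density; fun_prop
  have cu : ContDiffOn ℝ 1 velocity admissible := by
    unfold velocity; fun_prop (disch := assumption)
  have cT : ContDiffOn ℝ 1 temperature admissible := by
    unfold temperature; fun_prop (disch := assumption)
  have cα : ContDiffOn ℝ 1 (fun U => Real.log (density U / √(2 * Real.pi * temperature U)) -
      velocity U ^ 2 / (2 * temperature U)) admissible := by
    have h1 : ∀ U ∈ admissible, 2 * Real.pi * temperature U ≠ 0 := fun U hU =>
      mul_ne_zero (by positivity) (hT U hU)
    have h2 : ∀ U ∈ admissible, √(2 * Real.pi * temperature U) ≠ 0 := fun U hU => by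
      have := hU.2; positivity
    have h3 : ∀ U ∈ admissible, density U / √(2 * Real.pi * temperature U) ≠ 0 := fun U hU => by
      have := hU.2; have := hU.1; positivity
    have h4 : ∀ U ∈ admissible, 2 * temperature U ≠ 0 := fun U hU =>
      mul_ne_zero (by positivity) (hT U hU)
    exact ((cρ.div ((contDiffOn_const.mul cT).sqrt h1) h2).log h3).sub
      ((cu.pow 2).div (contDiffOn_const.mul cT) h4)
  have cβ : ContDiffOn ℝ 1 (fun U => velocity U / temperature U) admissible := cu.div cT hT
  have cγ : ContDiffOn ℝ 1 (fun U => 1 / (2 * temperature U)) admissible :=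
    contDiffOn_const.div (contDiffOn_const.mul cT) fun U hU =>
      mul_ne_zero (by positivity) (hT U hU)
  obtain ⟨A, hA0, hA, hA'⟩ := exists_lipschitz_of_contDiffOn hS isOpen_admissible hSΩ cα
  obtain ⟨B, hB0, hB, hB'⟩ := exists_lipschitz_of_contDiffOn hS isOpen_admissible hSΩ cβ
  obtain ⟨G, hG0, hG, hG'⟩ := exists_lipschitz_of_contDiffOn hS isOpen_admissible hSΩ cγ
  obtain ⟨D, hD0, hD, -⟩ := exists_lipschitz_of_contDiffOn hS isOpen_admissible hSΩ cT
  -- `D` bounds the temperature on `S`, so this is a uniform Gaussian decay rate; the `+ 1` excludes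
  -- a zero denominator. The weight `q + 2` used next leaves two powers of `1 + |v|` to absorb the
  -- quadratic growth of the difference of two exponents.
  have hg : 0 < 1 / (2 * (D + 1)) := by positivity
  obtain ⟨C, hC⟩ := exists_pow_mul_exp_le (q + 2) A B _ hg
  have hC0 : 0 ≤ C := le_trans (by positivity) (hC 0)
  have key : ∀ U ∈ S, ∀ v, (1 + |v|) ^ (q + 2) * maxwellian U v ≤ C := by
    intro U hU v
    refine le_trans ?_ (hC v)
    rw [maxwellian_eq_exp (hSΩ hU)]
    refine mul_le_mul_of_nonneg_left (Real.exp_le_exp.2 ?_) (by positivity)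
    have h1 := le_of_abs_le (hA U hU)
    have h2 : velocity U / temperature U * v ≤ B * |v| := by
      refine (le_abs_self _).trans ?_
      rw [abs_mul]
      exact mul_le_mul_of_nonneg_right (hB U hU) (abs_nonneg v)
    have h3 : 1 / (2 * (D + 1)) * v ^ 2 ≤ 1 / (2 * temperature U) * v ^ 2 := by
      have := (hSΩ hU).2
      have := le_of_abs_le (hD U hU)
      gcongr
      linarith
    linarith
  have hpos : ∀ U ∈ S, ∀ v, 0 < maxwellian U v := fun U hU v => by
    rw [maxwellian_eq_exp (hSΩ hU)]; exact Real.exp_pos _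
  have key' : ∀ U ∈ S, ∀ v, (1 + |v|) ^ q * |maxwellian U v| ≤ C := by
    intro U hU v
    rw [abs_of_pos (hpos U hU v)]
    refine le_trans ?_ (key U hU v)
    gcongr
    · exact (hpos U hU v).le
    · linarith [abs_nonneg v]
    · omega
  refine ⟨C + (A + B + G) * (2 * C), by positivity, fun U hU v => (key' U hU v).trans
    (le_add_of_nonneg_right (by positivity)), fun U hU V hV v => ?_⟩
  have h1 : |maxwellian U v - maxwellian V v| ≤
      ((A + B + G) * ‖U - V‖ * (1 + |v|) ^ 2) * (maxwellian U v + maxwellian V v) := by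
    have hpU := hpos U hU v
    have hpV := hpos V hV v
    rw [maxwellian_eq_exp (hSΩ hU), maxwellian_eq_exp (hSΩ hV)] at *
    refine (abs_exp_sub_exp_le _ _).trans (mul_le_mul_of_nonneg_right ?_ (by positivity))
    have e1 := hA' U hU V hV
    have e2 := hB' U hU V hV
    have e3 := hG' U hU V hV
    generalize Real.log (density U / √(2 * Real.pi * temperature U)) -
        velocity U ^ 2 / (2 * temperature U) = α at *
    generalize Real.log (density V / √(2 * Real.pi * temperature V)) -
        velocity V ^ 2 / (2 * temperature V) = α' at *
    generalize velocity U / temperature U = β at *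
    generalize velocity V / temperature V = β' at *
    generalize 1 / (2 * temperature U) = γ at *
    generalize 1 / (2 * temperature V) = γ' at *
    have e4 : α + β * v - γ * v ^ 2 - (α' + β' * v - γ' * v ^ 2) =
        (α - α') + (β - β') * v - (γ - γ') * v ^ 2 := by ring
    have n0 : 0 ≤ ‖U - V‖ := norm_nonneg _
    have hv := abs_nonneg v
    rw [e4]
    calc |(α - α') + (β - β') * v - (γ - γ') * v ^ 2|
        ≤ |α - α'| + |β - β'| * |v| + |γ - γ'| * |v| ^ 2 := by
          refine (abs_sub _ _).trans ?_
          rw [abs_mul, abs_pow, ← abs_mul (β - β')]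
          gcongr
          exact abs_add_le _ _
      _ ≤ A * ‖U - V‖ * (1 + |v|) ^ 2 + B * ‖U - V‖ * (1 + |v|) ^ 2
          + G * ‖U - V‖ * (1 + |v|) ^ 2 := by
          gcongr ?_ + ?_ + ?_
          · exact e1.trans (le_mul_of_one_le_right (by positivity) (by nlinarith))
          · exact mul_le_mul e2 (by nlinarith) hv (by positivity)
          · exact mul_le_mul e3 (by nlinarith) (by positivity) (by positivity)
      _ = _ := by ring
  calc (1 + |v|) ^ q * |maxwellian U v - maxwellian V v|
      ≤ (1 + |v|) ^ q * (((A + B + G) * ‖U - V‖ * (1 + |v|) ^ 2) *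
        (maxwellian U v + maxwellian V v)) := by gcongr
    _ = (A + B + G) * ‖U - V‖ * ((1 + |v|) ^ (q + 2) * maxwellian U v +
        (1 + |v|) ^ (q + 2) * maxwellian V v) := by ring
    _ ≤ (A + B + G) * ‖U - V‖ * (C + C) := by
        gcongr
        · exact key U hU v
        · exact key V hV v
    _ ≤ _ := by nlinarith [mul_nonneg hC0 (norm_nonneg (U - V))]

/-! ### The weighted norm and orders of magnitude in the Knudsen number -/

theorem wnorm_le_ofReal {q : ℕ} {f : Field} {C : ℝ}
    (h : ∀ x v, (1 + |v|) ^ q * |f x v| ≤ C) : wnorm q f ≤ ENNReal.ofReal C :=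
  iSup_le fun x => iSup_le fun v => ENNReal.ofReal_le_ofReal (h x v)

/-- The `max` is needed because `ENNReal.ofReal` sends negative constants to `0`. -/
theorem le_of_wnorm_le {q : ℕ} {f : Field} {C : ℝ} (h : wnorm q f ≤ ENNReal.ofReal C)
    (x v : ℝ) : (1 + |v|) ^ q * |f x v| ≤ max C 0 := by
  have h1 : ENNReal.ofReal ((1 + |v|) ^ q * |f x v|) ≤ ENNReal.ofReal C :=
    (le_iSup_of_le x (le_iSup (fun v => ENNReal.ofReal ((1 + |v|) ^ q * |f x v|)) v)).trans h
  rcases le_total 0 C with hC | hC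
  · exact ((ENNReal.ofReal_le_ofReal_iff hC).1 h1).trans (le_max_left _ _)
  · rw [ENNReal.ofReal_of_nonpos hC] at h1
    exact (ENNReal.ofReal_eq_zero.1 (le_antisymm h1 bot_le)).trans (le_max_right _ _)

/-- `F ε = O(ε^m)` in the weighted norm. -/
def FieldBigO (q m : ℕ) (F : ℝ → Field) : Prop :=
  ∃ C : ℝ, ∀ᶠ ε in 𝓝[>] (0 : ℝ), ∀ x v, (1 + |v|) ^ q * |F ε x v| ≤ C * ε ^ m

/-- `U ε = O(ε^m)` uniformly in `x`. -/
def StateBigO (m : ℕ) (U : ℝ → ℝ → State) : Prop :=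
  ∃ C : ℝ, ∀ᶠ ε in 𝓝[>] (0 : ℝ), ∀ x, ‖U ε x‖ ≤ C * ε ^ m

theorem eventually_pos : ∀ᶠ ε in 𝓝[>] (0 : ℝ), 0 < ε := self_mem_nhdsWithin

theorem FieldBigO.congr {q m : ℕ} {F G : ℝ → Field} (hF : FieldBigO q m F)
    (h : ∀ᶠ ε in 𝓝[>] (0 : ℝ), ∀ x v, G ε x v = F ε x v) : FieldBigO q m G := by
  obtain ⟨C, hC⟩ := hF
  refine ⟨C, ?_⟩
  filter_upwards [hC, h] with ε h1 h2 x v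
  rw [h2]; exact h1 x v

theorem FieldBigO.add {q m : ℕ} {F G : ℝ → Field} (hF : FieldBigO q m F)
    (hG : FieldBigO q m G) : FieldBigO q m (fun ε x v => F ε x v + G ε x v) := by
  obtain ⟨C, hC⟩ := hF
  obtain ⟨D, hD⟩ := hG
  refine ⟨C + D, ?_⟩
  filter_upwards [hC, hD] with ε h1 h2 x v
  calc (1 + |v|) ^ q * |F ε x v + G ε x v|
      ≤ (1 + |v|) ^ q * (|F ε x v| + |G ε x v|) := by gcongr; exact abs_add_le _ _
    _ ≤ _ := by linarith [h1 x v, h2 x v]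

theorem FieldBigO.mul {q m k : ℕ} {F : ℝ → Field} (hF : FieldBigO q m F) {c : ℝ → ℝ} {D : ℝ}
    (hc : ∀ᶠ ε in 𝓝[>] (0 : ℝ), |c ε| ≤ D * ε ^ k) :
    FieldBigO q (m + k) (fun ε x v => c ε * F ε x v) := by
  obtain ⟨C, hC⟩ := hF
  refine ⟨C * D, ?_⟩
  filter_upwards [hC, hc, eventually_pos] with ε h1 h2 h3 x v
  have h4 : 0 ≤ (1 + |v|) ^ q * |F ε x v| := by positivity
  calc (1 + |v|) ^ q * |c ε * F ε x v| = ((1 + |v|) ^ q * |F ε x v|) * |c ε| := by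
        rw [abs_mul]; ring
    _ ≤ (C * ε ^ m) * (D * ε ^ k) :=
        mul_le_mul (h1 x v) h2 (abs_nonneg _) (h4.trans (h1 x v))
    _ = _ := by ring

theorem FieldBigO.const_mul {q m : ℕ} {F : ℝ → Field} (hF : FieldBigO q m F) (c : ℝ) :
    FieldBigO q m (fun ε x v => c * F ε x v) :=
  hF.mul (k := 0) (c := fun _ => c) (D := |c|) (by simp)

theorem FieldBigO.sub {q m : ℕ} {F G : ℝ → Field} (hF : FieldBigO q m F)
    (hG : FieldBigO q m G) : FieldBigO q m (fun ε x v => F ε x v - G ε x v) :=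
  (hF.add (hG.const_mul (-1))).congr (Eventually.of_forall fun _ _ _ => by ring)

theorem FieldBigO.zero (q m : ℕ) : FieldBigO q m (fun _ _ _ => 0) :=
  ⟨0, by simp⟩

theorem FieldBigO.sum {q m : ℕ} {ι : Type*} (s : Finset ι) {F : ι → ℝ → Field}
    (h : ∀ i ∈ s, FieldBigO q m (F i)) : FieldBigO q m (fun ε x v => ∑ i ∈ s, F i ε x v) := by
  classical
  induction s using Finset.induction_on with
  | empty => simpa using FieldBigO.zero q m
  | insert a s ha ih =>
    simp only [Finset.sum_insert ha]
    exact (h a (by simp)).add (ih fun i hi => h i (by simp [hi]))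

theorem FieldBigO.bounded {q : ℕ} {F : ℝ → Field} (hF : FieldBigO q 1 F) : FieldBigO q 0 F := by
  obtain ⟨C, hC⟩ := hF
  refine ⟨|C|, ?_⟩
  have h1 : ∀ᶠ ε in 𝓝[>] (0 : ℝ), ε < 1 := nhdsWithin_le_nhds (gt_mem_nhds one_pos)
  filter_upwards [hC, h1, eventually_pos] with ε h1 h2 h3 x v
  refine (h1 x v).trans ?_
  rw [pow_one, pow_zero]
  exact mul_le_mul (le_abs_self C) h2.le h3.le (abs_nonneg _)

/-- Shifting along characteristics preserves the order of magnitude. -/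
theorem FieldBigO.shift {q m : ℕ} {F : ℝ → Field} (hF : FieldBigO q m F) (s : ℝ) :
    FieldBigO q m (fun ε x v => F ε (x - v * s) v) := by
  obtain ⟨C, hC⟩ := hF
  exact ⟨C, hC.mono fun ε h x v => h _ v⟩

theorem FieldBigO.of_wnorm {q : ℕ} {F : ℝ → Field}
    (h : ∃ C : ℝ, ∀ᶠ ε in 𝓝[>] (0 : ℝ), wnorm q (F ε) ≤ ENNReal.ofReal (C * ε)) :
    FieldBigO q 1 F := by
  obtain ⟨C, hC⟩ := h
  refine ⟨max C 0, ?_⟩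
  filter_upwards [hC, eventually_pos] with ε h1 h2 x v
  have := le_of_wnorm_le h1 x v
  rwa [pow_one, max_mul_of_nonneg _ _ h2.le, zero_mul]

theorem FieldBigO.wnorm_le {q : ℕ} {F : ℝ → Field} (h : FieldBigO q 1 F) :
    ∃ C : ℝ, ∀ᶠ ε in 𝓝[>] (0 : ℝ), wnorm q (F ε) ≤ ENNReal.ofReal (C * ε) := by
  obtain ⟨C, hC⟩ := h
  exact ⟨C, hC.mono fun ε h => wnorm_le_ofReal fun x v => by simpa using h x v⟩

theorem WellPrepared.bounded {q : ℕ} {f : ℝ → Field} (hf : WellPrepared q f) :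
    FieldBigO q 0 f := by
  obtain ⟨g, hg, -, h⟩ := hf
  -- `h 0` is the expansion truncated after its leading term, with remainder `O(ε)`.
  have h1 : FieldBigO q 0 (fun ε x v => f ε x v - g 0 x v) :=
    (FieldBigO.of_wnorm (by simpa using h 0)).bounded
  have h2 : FieldBigO q 0 (fun _ => g 0) := by
    refine ⟨max (wnorm q (g 0)).toReal 0, Eventually.of_forall fun ε x v => ?_⟩
    rw [pow_zero, mul_one]
    exact le_of_wnorm_le (ENNReal.ofReal_toReal (hg 0).ne).ge x v
  exact (h1.add h2).congr (Eventually.of_forall fun _ _ _ => by ring)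

/-! ### Moments of weighted functions -/

/-- This is where `q ≥ 5` enters: three powers of the weight pay for the cubic growth of the energy
flux, and two more leave the integrable majorant `(1 + |v|)^(-2)`. -/
theorem integrable_mul_of_weighted {q : ℕ} (hq : 5 ≤ q) {g φ : ℝ → ℝ} (hg : Measurable g)
    (hφ : Measurable φ) (hφ3 : ∀ v, |φ v| ≤ (1 + |v|) ^ 3) {C : ℝ}
    (h : ∀ v, (1 + |v|) ^ q * |g v| ≤ C) :
    Integrable (fun v => g v * φ v) ∧
      |∫ v, g v * φ v| ≤ C * ∫ v : ℝ, (1 + ‖v‖) ^ (-2 : ℝ) := by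
  have hi : Integrable (fun v : ℝ => C * (1 + ‖v‖) ^ (-2 : ℝ)) :=
    (integrable_one_add_norm (by simp)).const_mul C
  have hb : ∀ v, ‖g v * φ v‖ ≤ C * (1 + ‖v‖) ^ (-2 : ℝ) := by
    intro v
    have h1 : 1 ≤ 1 + |v| := by linarith [abs_nonneg v]
    rw [Real.norm_eq_abs, Real.norm_eq_abs, Real.rpow_neg (by positivity), ← div_eq_mul_inv,
      le_div_iff₀ (by positivity), abs_mul]
    have h2 : (1 + |v|) ^ (2 : ℝ) = (1 + |v|) ^ 2 := by norm_cast
    rw [h2]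
    calc |g v| * |φ v| * (1 + |v|) ^ 2 ≤ |g v| * (1 + |v|) ^ 3 * (1 + |v|) ^ 2 := by
          gcongr; exact hφ3 v
      _ = (1 + |v|) ^ 5 * |g v| := by ring
      _ ≤ (1 + |v|) ^ q * |g v| := by gcongr
      _ ≤ C := h v
  refine ⟨hi.mono' (hg.mul hφ).aestronglyMeasurable (Eventually.of_forall hb), ?_⟩
  rw [← integral_const_mul]
  exact norm_integral_le_of_norm_le hi (Eventually.of_forall hb)

theorem measurable_collisionInvariant (i : Fin 3) :
    Measurable fun v => collisionInvariant v i := by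
  fin_cases i <;> simp [collisionInvariant] <;> fun_prop

theorem abs_collisionInvariant_le (v : ℝ) (i : Fin 3) :
    |collisionInvariant v i| ≤ (1 + |v|) ^ 2 := by
  have h := abs_nonneg v
  fin_cases i
  · change |(1 : ℝ)| ≤ _
    rw [abs_one]; nlinarith
  · change |v| ≤ _
    nlinarith
  · change |v ^ 2 / 2| ≤ _
    rw [abs_of_nonneg (by positivity)]; nlinarith [sq_abs v]

theorem abs_collisionInvariant_le' (v : ℝ) (i : Fin 3) :
    |collisionInvariant v i| ≤ (1 + |v|) ^ 3 :=
  (abs_collisionInvariant_le v i).trans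
    (pow_le_pow_right₀ (by linarith [abs_nonneg v]) (by norm_num))

theorem abs_mul_collisionInvariant_le (v : ℝ) (i : Fin 3) :
    |v * collisionInvariant v i| ≤ (1 + |v|) ^ 3 := by
  rw [abs_mul, pow_succ']
  exact mul_le_mul (by linarith) (abs_collisionInvariant_le v i) (abs_nonneg _) (by positivity)

/-- Integration against a family of weights of at most cubic growth, such as the moments and the
macroscopic flux. -/
theorem stateBigO_integral {q m : ℕ} (hq : 5 ≤ q) {F : ℝ → Field} (hF : FieldBigO q m F)
    (hm : ∀ᶠ ε in 𝓝[>] (0 : ℝ), ∀ x, Measurable (F ε x)) {φ : Fin 3 → ℝ → ℝ}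
    (hφ : ∀ i, Measurable (φ i)) (hφ3 : ∀ i v, |φ i v| ≤ (1 + |v|) ^ 3) :
    StateBigO m (fun ε x i => ∫ v, F ε x v * φ i v) := by
  obtain ⟨C, hC⟩ := hF
  refine ⟨C * ∫ v : ℝ, (1 + ‖v‖) ^ (-2 : ℝ), ?_⟩
  filter_upwards [hC, hm] with ε h1 h2 x
  have h3 : ∀ i, ‖∫ v, F ε x v * φ i v‖ ≤ (C * ε ^ m) * ∫ v : ℝ, (1 + ‖v‖) ^ (-2 : ℝ) :=
    fun i => (integrable_mul_of_weighted hq (h2 x) (hφ i) (hφ3 i) (h1 x)).2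
  rw [mul_right_comm] at h3
  exact (pi_norm_le_iff_of_nonneg ((norm_nonneg _).trans (h3 0))).2 h3

theorem integral_sub_weighted {q : ℕ} (hq : 5 ≤ q) {f g φ : ℝ → ℝ} (hf : Measurable f)
    (hg : Measurable g) (hφ : Measurable φ) (hφ3 : ∀ v, |φ v| ≤ (1 + |v|) ^ 3) {C D : ℝ}
    (hC : ∀ v, (1 + |v|) ^ q * |f v| ≤ C) (hD : ∀ v, (1 + |v|) ^ q * |g v| ≤ D) :
    ∫ v, (f v - g v) * φ v = (∫ v, f v * φ v) - ∫ v, g v * φ v := by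
  rw [← integral_sub (integrable_mul_of_weighted hq hf hφ hφ3 hC).1
    (integrable_mul_of_weighted hq hg hφ hφ3 hD).1]
  simp only [sub_mul]

theorem StateBigO.congr {m : ℕ} {U V : ℝ → ℝ → State} (hU : StateBigO m U)
    (h : ∀ᶠ ε in 𝓝[>] (0 : ℝ), ∀ x, V ε x = U ε x) : StateBigO m V := by
  obtain ⟨C, hC⟩ := hU
  refine ⟨C, ?_⟩
  filter_upwards [hC, h] with ε h1 h2 x
  rw [h2]; exact h1 x

/-- The order-zero bounds on `F` and `G` provide the integrability needed to split the integral of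
the difference. -/
theorem StateBigO.of_field_sub {q m : ℕ} (hq : 5 ≤ q) {F G : ℝ → Field}
    (hF : FieldBigO q 0 F) (hG : FieldBigO q 0 G)
    (hFm : ∀ᶠ ε in 𝓝[>] (0 : ℝ), ∀ x, Measurable (F ε x))
    (hGm : ∀ᶠ ε in 𝓝[>] (0 : ℝ), ∀ x, Measurable (G ε x))
    (h : FieldBigO q m (fun ε x v => F ε x v - G ε x v)) {φ : Fin 3 → ℝ → ℝ}
    (hφ : ∀ i, Measurable (φ i)) (hφ3 : ∀ i v, |φ i v| ≤ (1 + |v|) ^ 3) :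
    StateBigO m (fun ε x => (fun i => ∫ v, F ε x v * φ i v) - fun i => ∫ v, G ε x v * φ i v) := by
  refine (stateBigO_integral hq h ?_ hφ hφ3).congr ?_
  · filter_upwards [hFm, hGm] with ε h1 h2 x using (h1 x).sub (h2 x)
  · obtain ⟨C, hC⟩ := hF
    obtain ⟨D, hD⟩ := hG
    filter_upwards [hFm, hGm, hC, hD] with ε h1 h2 h3 h4 x
    funext i
    exact (integral_sub_weighted hq (h1 x) (h2 x) (hφ i) (hφ3 i) (h3 x) (h4 x)).symm

/-! ### Uniformly admissible macroscopic states -/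

/-- For small `ε` all states lie in a fixed compact set of admissible states. -/
def UniformlyAdmissible (U : ℝ → ℝ → State) : Prop :=
  ∃ S, IsCompact S ∧ S ⊆ admissible ∧ ∀ᶠ ε in 𝓝[>] (0 : ℝ), ∀ x, U ε x ∈ S

theorem NonDegenerate.uniformlyAdmissible {U : ℝ → ℝ → State} (h : NonDegenerate U) {K : ℝ}
    (hK : ∀ᶠ ε in 𝓝[>] (0 : ℝ), ∀ x, ‖U ε x‖ ≤ K) : UniformlyAdmissible U := by
  obtain ⟨ρm, hρ, Tm, hT, h⟩ := h
  refine ⟨boundedStates ρm Tm K, isCompact_boundedStates hρ Tm K, boundedStates_subset hρ hT, ?_⟩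
  filter_upwards [h, hK] with ε h1 h2 x using ⟨(h1 x).1, (h1 x).2, h2 x⟩

theorem UniformlyAdmissible.eventually {U : ℝ → ℝ → State} (h : UniformlyAdmissible U) :
    ∀ᶠ ε in 𝓝[>] (0 : ℝ), ∀ x, U ε x ∈ admissible := by
  obtain ⟨S, -, hS, h⟩ := h
  exact h.mono fun ε h x => hS (h x)

/-- The admissible set is open, so some closed thickening of the compact set stays inside it, and an
`O(ε)` perturbation eventually lies in that thickening. -/
theorem UniformlyAdmissible.perturb {U V : ℝ → ℝ → State} (hU : UniformlyAdmissible U)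
    (h : StateBigO 1 (fun ε x => V ε x - U ε x)) : UniformlyAdmissible V := by
  obtain ⟨S, hS, hSΩ, hU⟩ := hU
  obtain ⟨δ, hδ, hδΩ⟩ := hS.exists_cthickening_subset_open isOpen_admissible hSΩ
  refine ⟨_, hS.cthickening, hδΩ, ?_⟩
  obtain ⟨C, hC⟩ := h
  have h1 : ∀ᶠ ε in 𝓝[>] (0 : ℝ), C * ε < δ := by
    have : Tendsto (fun ε : ℝ => C * ε) (𝓝 0) (𝓝 (C * 0)) :=
      (continuous_const_mul C).tendsto 0
    rw [mul_zero] at this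
    exact nhdsWithin_le_nhds (this.eventually (gt_mem_nhds hδ))
  filter_upwards [hC, h1, hU] with ε h1 h2 h3 x
  refine Metric.mem_cthickening_of_dist_le _ _ _ _ (h3 x) ?_
  rw [dist_eq_norm]
  have := h1 x
  rw [pow_one] at this
  exact this.trans h2.le

theorem UniformlyAdmissible.bounded {U : ℝ → ℝ → State} (hU : UniformlyAdmissible U) (q : ℕ) :
    FieldBigO q 0 (fun ε => localMaxwellian (U ε)) := by
  obtain ⟨S, hS, hSΩ, hU⟩ := hU
  obtain ⟨C, -, hC, -⟩ := exists_maxwellian_bounds hS hSΩ q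
  refine ⟨C, hU.mono fun ε h x v => ?_⟩
  rw [pow_zero, mul_one]
  exact hC _ (h x) v

theorem UniformlyAdmissible.maxwellian_sub {U V : ℝ → ℝ → State} (hU : UniformlyAdmissible U)
    (h : StateBigO 1 (fun ε x => V ε x - U ε x)) (q : ℕ) :
    FieldBigO q 1 (fun ε x v => localMaxwellian (V ε) x v - localMaxwellian (U ε) x v) := by
  obtain ⟨S', hS', hSΩ', hV⟩ := hU.perturb h
  obtain ⟨S, hS, hSΩ, hU⟩ := hU
  obtain ⟨C, hC0, -, hC⟩ :=
    exists_maxwellian_bounds (hS.union hS') (Set.union_subset hSΩ hSΩ') q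
  obtain ⟨D, hD⟩ := h
  refine ⟨C * D, ?_⟩
  filter_upwards [hU, hV, hD] with ε h1 h2 h3 x v
  refine (hC _ (Or.inr (h2 x)) _ (Or.inl (h1 x)) v).trans ?_
  rw [mul_assoc]
  exact mul_le_mul_of_nonneg_left (h3 x) hC0

theorem continuous_maxwellian (U : State) : Continuous (maxwellian U) := by
  unfold maxwellian; fun_prop

/-- A field that is `O(ε)`-close to a local Maxwellian is `O(ε)`-close to its own local Maxwellian,
and its moments and flux are those of the Maxwellian up to `O(ε)`. -/
theorem UniformlyAdmissible.closure {q : ℕ} (hq : 5 ≤ q) {U : ℝ → ℝ → State}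
    (hU : UniformlyAdmissible U) {F : ℝ → Field}
    (hm : ∀ᶠ ε in 𝓝[>] (0 : ℝ), ∀ x, Measurable (F ε x))
    (h : FieldBigO q 1 (fun ε x v => F ε x v - localMaxwellian (U ε) x v)) :
    StateBigO 1 (fun ε x => moments (F ε) x - U ε x) ∧
    FieldBigO q 1 (fun ε x v => F ε x v - localMaxwellian (moments (F ε)) x v) ∧
    StateBigO 1 (fun ε x => flux (F ε) x - eulerFlux (U ε x)) := by
  have hM := hU.bounded q
  have hF : FieldBigO q 0 F :=
    (h.bounded.add hM).congr (Eventually.of_forall fun _ _ _ => by ring)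
  have hMm : ∀ᶠ ε in 𝓝[>] (0 : ℝ), ∀ x, Measurable (localMaxwellian (U ε) x) :=
    Eventually.of_forall fun ε x => (continuous_maxwellian _).measurable
  have h1 : StateBigO 1 (fun ε x => moments (F ε) x - U ε x) := by
    refine (StateBigO.of_field_sub hq hF hM hm hMm h measurable_collisionInvariant
      (fun i v => abs_collisionInvariant_le' v i)).congr ?_
    filter_upwards [hU.eventually] with ε h1 x
    rw [← moments_localMaxwellian (h1 x)]
    rfl
  refine ⟨h1, ?_, ?_⟩
  -- `F - M_{U(F)} = (F - M_U) - (M_{U(F)} - M_U)`, and the second difference is `O(ε)` by the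
  -- Lipschitz bound, as the moments of `F` differ from `U` by `O(ε)`.
  · exact (h.sub (hU.maxwellian_sub h1 q)).congr (Eventually.of_forall fun _ _ _ => by ring)
  · exact StateBigO.of_field_sub hq hF hM hm hMm h
      (fun i => measurable_id.mul (measurable_collisionInvariant i))
      (fun i v => abs_mul_collisionInvariant_le v i)

section

/-! ### Measurability of the scheme -/

theorem measurable_slice {f : Field} (hf : Measurable (Function.uncurry f)) (x : ℝ) :
    Measurable (f x) :=
  hf.comp measurable_prodMk_left

theorem measurable_moments {f : Field} (hf : Measurable (Function.uncurry f)) :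
    Measurable (moments f) := by
  refine measurable_pi_iff.2 fun i => ?_
  have h : Measurable fun z : ℝ × ℝ => f z.1 z.2 * collisionInvariant z.2 i :=
    hf.mul ((measurable_collisionInvariant i).comp measurable_snd)
  exact (h.stronglyMeasurable.integral_prod_right' (ν := volume)).measurable

theorem measurable_localMaxwellian {U : ℝ → State} (hU : Measurable U) :
    Measurable (Function.uncurry (localMaxwellian U)) := by
  have h : ∀ i, Measurable fun z : ℝ × ℝ => U z.1 i := fun i =>
    ((measurable_pi_apply i).comp hU).comp measurable_fst
  have h0 := h 0
  have h1 := h 1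
  have h2 := h 2
  simp only [Function.uncurry_def, localMaxwellian, maxwellian, temperature, velocity, density]
  fun_prop

theorem measurable_shift {f : Field} (hf : Measurable (Function.uncurry f)) (s : ℝ) :
    Measurable (Function.uncurry fun x v => f (x - v * s) v) :=
  hf.comp (f := fun z : ℝ × ℝ => (z.1 - z.2 * s, z.2)) (by fun_prop)

theorem measurable_slUpdate {r : ℕ} (T : ButcherTableau r) (Δt ε : ℝ) {f : Field}
    (hf : Measurable (Function.uncurry f)) {g : Fin (r + 1) → Field} {k : Fin (r + 1)}
    (hg : ∀ l < k, Measurable (Function.uncurry (g l))) :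
    Measurable (Function.uncurry (slUpdate T Δt ε f g k)) := by
  refine (measurable_shift hf _).add (Measurable.const_mul ?_ Δt)
  refine Finset.measurable_fun_sum _ fun l hl => ?_
  have h := hg l (Finset.mem_Iio.1 hl)
  exact (((measurable_shift (measurable_localMaxwellian (measurable_moments h)) _).sub
    (measurable_shift h _)).div_const ε).const_mul _

theorem measurable_collisionUpdate (a Δt ε : ℝ) {f : Field}
    (hf : Measurable (Function.uncurry f)) :
    Measurable (Function.uncurry (collisionUpdate a Δt ε f)) :=
  ((hf.const_mul ε).add ((measurable_localMaxwellian (measurable_moments hf)).const_mul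
    (a * Δt))).div_const _

theorem Compression.ACASteps.measurable {P : Compression} {A : Field}
    (hA : Measurable (Function.uncurry A)) {k : ℕ} {I : Finset (Fin P.Nx)}
    {J : Finset (Fin P.Nv)} {B : Field} {δ : EReal} (h : P.ACASteps A k I J B δ) :
    Measurable (Function.uncurry B) := by
  induction h with
  | zero => exact measurable_const
  | step k I J B R δ _ _ _ residual _ _ _ _ i _ j _ _ ih =>
    have hR : Measurable (Function.uncurry R) := by rw [residual]; exact hA.sub ih
    refine ih.add (Measurable.const_mul (Measurable.mul ?_ ?_) _)
    · exact hR.comp (f := fun z : ℝ × ℝ => (z.1, P.vs j)) (by fun_prop)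
    · exact hR.comp (f := fun z : ℝ × ℝ => (P.xs i, z.2)) (by fun_prop)

theorem Compression.IsCUR.measurable {P : Compression} {A B : Field} (h : P.IsCUR A B)
    (hA : Measurable (Function.uncurry A)) : Measurable (Function.uncurry B) := by
  obtain ⟨k, I, J, δ, h, -⟩ := h
  exact h.measurable hA

/-- The singular vectors are recovered from mesh sections of the field. -/
theorem Compression.IsSVDTruncation.measurable {P : Compression} {A B : Field}
    (h : P.IsSVDTruncation A B) (hA : Measurable (Function.uncurry A)) :
    Measurable (Function.uncurry B) := by
  obtain ⟨m, σ, u, w, hσ, -, hu, hw, hAe, hBe⟩ := h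
  have hu' : ∀ a, Measurable (u a) := by
    intro a
    have e : u a = fun x => (σ a)⁻¹ * ∑ j, A x (P.vs j) * w a (P.vs j) := by
      funext x
      have : ∑ j, A x (P.vs j) * w a (P.vs j) =
          ∑ b, σ b * u b x * ∑ j, w b (P.vs j) * w a (P.vs j) := by
        simp only [hAe, Finset.sum_mul, Finset.mul_sum]
        rw [Finset.sum_comm]
        simp only [mul_assoc]
      rw [this]
      simp only [hw, mul_ite, mul_one, mul_zero, Finset.sum_ite_eq', Finset.mem_univ, if_true]
      rw [inv_mul_cancel_left₀ (hσ a).ne']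
    rw [e]
    refine (Finset.measurable_fun_sum _ fun j _ => ?_).const_mul _
    exact (hA.comp (f := fun x : ℝ => (x, P.vs j)) (by fun_prop)).mul_const _
  have hw' : ∀ a, Measurable (w a) := by
    intro a
    have e : w a = fun v => (σ a)⁻¹ * ∑ i, A (P.xs i) v * u a (P.xs i) := by
      funext v
      have : ∑ i, A (P.xs i) v * u a (P.xs i) =
          ∑ b, σ b * w b v * ∑ i, u b (P.xs i) * u a (P.xs i) := by
        simp only [hAe, Finset.sum_mul, Finset.mul_sum]
        rw [Finset.sum_comm]
        exact Finset.sum_congr rfl fun _ _ => Finset.sum_congr rfl fun _ _ => by ring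
      rw [this]
      simp only [hu, mul_ite, mul_one, mul_zero, Finset.sum_ite_eq', Finset.mem_univ, if_true]
      rw [inv_mul_cancel_left₀ (hσ a).ne']
    rw [e]
    refine (Finset.measurable_fun_sum _ fun j _ => ?_).const_mul _
    exact (measurable_slice hA _).mul_const _
  have e : Function.uncurry B = fun z : ℝ × ℝ =>
      ∑ a, if P.epsS ≤ σ a then σ a * u a z.1 * w a z.2 else 0 := by
    funext z; exact hBe z.1 z.2
  rw [e]
  refine Finset.measurable_fun_sum _ fun a _ => ?_
  split_ifs
  · exact (((hu' a).comp measurable_fst).const_mul _).mul ((hw' a).comp measurable_snd)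
  · exact measurable_const

variable {r : ℕ} {R : Trajectory r} {T : ButcherTableau r} {P : Compression} {Δt ε : ℝ} {N : ℕ}
  {f : Field}

theorem Trajectory.IsRun.measurable_stages (h : R.IsRun T P Δt ε N f) {n : ℕ} (hn : n < N)
    (hkin : Measurable (Function.uncurry (R.kin n))) (hmac : Measurable (R.mac n))
    (k : Fin (r + 1)) :
    Measurable (Function.uncurry (R.starSVD n k)) ∧ Measurable (R.stageMac n k) ∧
      Measurable (Function.uncurry (R.stageKin n k)) := by
  induction k using WellFoundedLT.induction with
  | ind k ih =>
    have h1 : Measurable (Function.uncurry (R.fullSL T Δt ε n k)) :=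
      measurable_slUpdate T Δt ε hkin fun l hl => (ih l hl).2.2
    have h2 := (h.starSVD_spec n hn k).measurable ((h.starCUR_spec n hn k).measurable
      (measurable_collisionUpdate _ _ _ ((h.slSVD_spec n hn k).measurable
        ((h.slCUR_spec n hn k).measurable h1))))
    have h3 : Measurable (R.stageMac n k) := by
      rw [funext (h.macroscopic n hn k)]
      refine hmac.sub (Measurable.const_smul (Finset.measurable_fun_sum _ fun l _ => ?_) Δt)
      -- `deriv` of an arbitrary function of a real variable is measurable, so measurability of the
      -- flux itself need not be tracked.
      exact (measurable_deriv (flux (R.stageKin n l))).const_smul (T.A k l)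
    refine ⟨h2, h3, ?_⟩
    rw [funext fun x => funext (h.correction n hn k x)]
    exact (h2.sub (measurable_localMaxwellian (measurable_moments h2))).add
      (measurable_localMaxwellian h3)

theorem Trajectory.IsRun.measurable (h : R.IsRun T P Δt ε N f)
    (hf : Measurable (Function.uncurry f)) {n : ℕ} (hn : n ≤ N) :
    Measurable (Function.uncurry (R.kin n)) ∧ Measurable (R.mac n) := by
  induction n with
  | zero => rw [h.kin_zero, h.mac_zero]; exact ⟨hf, measurable_moments hf⟩
  | succ n ih =>
    obtain ⟨h1, h2⟩ := ih (by omega)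
    have h3 := h.measurable_stages (by omega : n < N) h1 h2 (Fin.last r)
    rw [h.kin_succ n (by omega), h.mac_succ n (by omega)]
    exact ⟨h3.2.2, h3.2.1⟩

end

section

/-! ### Closeness to equilibrium -/

theorem FieldBigO.div_self {q : ℕ} {F : ℝ → Field} (hF : FieldBigO q 1 F) :
    FieldBigO q 0 (fun ε x v => F ε x v / ε) := by
  obtain ⟨C, hC⟩ := hF
  refine ⟨C, ?_⟩
  filter_upwards [hC, eventually_pos] with ε h1 h2 x v
  rw [abs_div, abs_of_pos h2, pow_zero, mul_one, ← mul_div_assoc, div_le_iff₀ h2]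
  simpa using h1 x v

/-- No sign is assumed on the diagonal of `A`, so `b` may be negative; for `ε < |b| / 2` the
denominator still stays above `|b| / 2` in absolute value. -/
theorem relaxation_factor_le {b : ℝ} (hb : b ≠ 0) :
    ∀ᶠ ε in 𝓝[>] (0 : ℝ), ε + b ≠ 0 ∧ |ε / (ε + b)| ≤ 2 / |b| * ε ^ 1 := by
  have hb' : 0 < |b| / 2 := by positivity
  filter_upwards [eventually_pos, nhdsWithin_le_nhds (gt_mem_nhds hb')] with ε h1 h2
  have h3 : |b| / 2 ≤ |ε + b| := by
    have h4 := abs_sub_abs_le_abs_sub b (-ε)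
    rw [abs_neg, abs_of_pos h1, sub_neg_eq_add, add_comm b] at h4
    linarith
  refine ⟨abs_pos.1 (hb'.trans_le h3), ?_⟩
  rw [abs_div, abs_of_pos h1, pow_one, div_mul_eq_mul_div,
    div_le_div_iff₀ (hb'.trans_le h3) (by positivity)]
  nlinarith

/-- The distance of `F` to its Maxwellian is multiplied by exactly `ε / (ε + a Δt)`, which is
`O(ε)`. -/
theorem collisionUpdate_near_equilibrium {q : ℕ} {F : ℝ → Field} (hF : FieldBigO q 0 F)
    (hU : UniformlyAdmissible fun ε => moments (F ε)) {a Δt : ℝ} (h : a * Δt ≠ 0) :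
    FieldBigO q 1 (fun ε x v =>
      collisionUpdate a Δt ε (F ε) x v - localMaxwellian (moments (F ε)) x v) := by
  refine ((hF.sub (hU.bounded q)).mul (k := 1)
    ((relaxation_factor_le h).mono fun _ h => h.2)).congr ?_
  filter_upwards [relaxation_factor_le h] with ε h1 x v
  have := h1.1
  simp only [collisionUpdate]
  field_simp
  ring

variable {r : ℕ} {T : ButcherTableau r}

theorem ButcherTableau.IsStifflyAccurateDIRK.diag_ne_zero (hT : T.IsStifflyAccurateDIRK)
    (k : Fin (r + 1)) : T.A k k ≠ 0 := by
  have h : T.A.BlockTriangular OrderDual.toDual := fun i j hij => hT.lower i j hij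
  have hdet := hT.invertible.ne_zero
  rw [Matrix.det_of_isLowerTriangular _ h] at hdet
  exact Finset.prod_ne_zero_iff.1 hdet k (Finset.mem_univ k)

/-- The stiff term `(M - g) / ε` is bounded because earlier stages are `O(ε)`-close to equilibrium.
Transport shifts `x` only, so it does not affect the weight in `v`. -/
theorem slUpdate_bounded {q : ℕ} (Δt : ℝ) {f : ℝ → Field} (hf : FieldBigO q 0 f)
    {g : ℝ → Fin (r + 1) → Field} {k : Fin (r + 1)}
    (hg : ∀ l < k, FieldBigO q 1
      (fun ε x v => g ε l x v - localMaxwellian (moments (g ε l)) x v)) :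
    FieldBigO q 0 (fun ε => slUpdate T Δt ε (f ε) (g ε) k) := by
  refine (hf.shift (T.c k * Δt)).add ((FieldBigO.sum _ fun l hl => ?_).const_mul Δt)
  refine FieldBigO.const_mul (F := fun ε x v => _) ?_ (T.A k l)
  exact ((((hg l (Finset.mem_Iio.1 hl)).const_mul (-1)).div_self).shift
    ((T.c k - T.c l) * Δt)).congr (Eventually.of_forall fun ε x v => by ring)

/-- Runs of the scheme with a fixed time step, for all small Knudsen numbers, under the hypotheses
of the convergence theorem. -/
structure AdmissibleRuns (q : ℕ) (T : ButcherTableau r) (P : ℝ → Compression) (Δt : ℝ) (N : ℕ)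
    (f : ℝ → Field) (R : ℝ → Trajectory r) : Prop where
  pos : 0 < Δt
  tableau : T.IsStifflyAccurateDIRK
  weight : 5 ≤ q
  measurable : ∀ ε > 0, Measurable (Function.uncurry (f ε))
  bounded : FieldBigO q 0 f
  run : ∀ᶠ ε in 𝓝[>] (0 : ℝ), (R ε).IsRun T (P ε) Δt ε N (f ε)
  kinetic : ∀ n < N, ∀ k, NonDegenerate (fun ε => moments ((R ε).fullSL T Δt ε n k))
  macroscopic : ∀ n < N, ∀ k, UniformlyAdmissible (fun ε => (R ε).stageMac n k)
  svd_error : ∀ n < N, ∀ k, FieldBigO q 1 (fun ε => (R ε).errSVD n k)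
  cur_error : ∀ n < N, ∀ k, FieldBigO q 1 (fun ε => (R ε).errCUR T Δt ε n k)

variable {q : ℕ} {P : ℝ → Compression} {Δt : ℝ} {N : ℕ} {f : ℝ → Field} {R : ℝ → Trajectory r}

theorem AdmissibleRuns.measurable_stageKin (h : AdmissibleRuns q T P Δt N f R) {n : ℕ}
    (hn : n < N) (k : Fin (r + 1)) :
    ∀ᶠ ε in 𝓝[>] (0 : ℝ), Measurable (Function.uncurry ((R ε).fullSL T Δt ε n k)) ∧
      Measurable (Function.uncurry ((R ε).starSVD n k)) ∧
      Measurable (Function.uncurry ((R ε).stageKin n k)) := by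
  filter_upwards [h.run, eventually_pos] with ε h1 h2
  obtain ⟨h3, h4⟩ := h1.measurable (h.measurable ε h2) hn.le
  have h5 := h1.measurable_stages hn h3 h4
  exact ⟨measurable_slUpdate T Δt ε h3 fun l _ => (h5 l).2.2, (h5 k).1, (h5 k).2.2⟩

/-- One stage: it is close to the Maxwellian of its macroscopic value if the solution at the old time
level is bounded and the earlier stages are close to equilibrium. -/
theorem AdmissibleRuns.stage (h : AdmissibleRuns q T P Δt N f R) {n : ℕ} (hn : n < N)
    {k : Fin (r + 1)} (hkin : FieldBigO q 0 (fun ε => (R ε).kin n))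
    (hl : ∀ l < k, FieldBigO q 1 (fun ε x v => (R ε).stageKin n l x v -
      localMaxwellian (moments ((R ε).stageKin n l)) x v)) :
    FieldBigO q 1 (fun ε x v => (R ε).stageKin n k x v -
      localMaxwellian ((R ε).stageMac n k) x v) := by
  have hm := h.measurable_stageKin hn k
  have hSL : FieldBigO q 0 (fun ε => (R ε).fullSL T Δt ε n k) :=
    slUpdate_bounded (g := fun ε => (R ε).stageKin n) Δt hkin hl
  -- The upper bound on these moments comes from the weighted bound of the field; only the lower
  -- bounds on density and temperature are assumed.
  have hUA : UniformlyAdmissible fun ε => moments ((R ε).fullSL T Δt ε n k) := by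
    obtain ⟨K, hK⟩ : StateBigO 0 fun ε => moments ((R ε).fullSL T Δt ε n k) :=
      stateBigO_integral h.weight hSL (hm.mono fun ε h x => measurable_slice h.1 x)
        measurable_collisionInvariant (fun i v => abs_collisionInvariant_le' v i)
    exact (h.kinetic n hn k).uniformlyAdmissible (K := K) (by simpa using hK)
  have hstage : FieldBigO q 1 (fun ε x v => (R ε).fullStage T Δt ε n k x v -
      localMaxwellian (moments ((R ε).fullSL T Δt ε n k)) x v) :=
    collisionUpdate_near_equilibrium hSL hUA
      (mul_ne_zero (h.tableau.diag_ne_zero k) h.pos.ne')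
  have hstar : FieldBigO q 1 (fun ε x v => (R ε).starSVD n k x v -
      localMaxwellian (moments ((R ε).fullSL T Δt ε n k)) x v) :=
    (((h.svd_error n hn k).add (h.cur_error n hn k)).add hstage).congr
      (Eventually.of_forall fun ε x v => by
        simp only [Trajectory.errSVD, Trajectory.errCUR]; ring)
  -- By the LoMaC correction, `F^(k) - M_{U^(k)}` is literally `F^* - M_{U(F^*)}`, so the closure
  -- estimate for `F^*` is what is wanted.
  refine (hUA.closure h.weight (hm.mono fun ε h x => measurable_slice h.2.1 x) hstar).2.1.congr ?_
  filter_upwards [h.run] with ε h1 x v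
  rw [h1.correction n hn k]
  ring

theorem AdmissibleRuns.stage_closure (h : AdmissibleRuns q T P Δt N f R) {n : ℕ} (hn : n < N)
    {k : Fin (r + 1)} (hk : FieldBigO q 1 (fun ε x v => (R ε).stageKin n k x v -
      localMaxwellian ((R ε).stageMac n k) x v)) :
    FieldBigO q 1 (fun ε x v => (R ε).stageKin n k x v -
      localMaxwellian (moments ((R ε).stageKin n k)) x v) ∧
    StateBigO 1 (fun ε x =>
      flux ((R ε).stageKin n k) x - eulerFlux ((R ε).stageMac n k x)) :=
  ((h.macroscopic n hn k).closure h.weight ((h.measurable_stageKin hn k).mono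
    fun _ h x => measurable_slice h.2.2 x) hk).2

/-- Induction over stages inside an induction over steps. Between steps only boundedness of the
kinetic solution is passed on, and it follows because the last stage is near a bounded Maxwellian.
-/
theorem AdmissibleRuns.near_maxwellian (h : AdmissibleRuns q T P Δt N f R) {n : ℕ} (hn : n < N)
    (k : Fin (r + 1)) :
    FieldBigO q 1 (fun ε x v => (R ε).stageKin n k x v -
      localMaxwellian ((R ε).stageMac n k) x v) := by
  have step : ∀ n < N, FieldBigO q 0 (fun ε => (R ε).kin n) → ∀ k,
      FieldBigO q 1 (fun ε x v => (R ε).stageKin n k x v -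
        localMaxwellian ((R ε).stageMac n k) x v) := by
    intro n hn hkin k
    induction k using WellFoundedLT.induction with
    | ind k ih => exact h.stage hn hkin fun l hl => (h.stage_closure hn (ih l hl)).1
  have hkin : ∀ n ≤ N, FieldBigO q 0 (fun ε => (R ε).kin n) := by
    intro n hn
    induction n with
    | zero =>
      refine h.bounded.congr ?_
      filter_upwards [h.run] with ε h1 x v
      rw [h1.kin_zero]
    | succ n ih =>
      refine ((step n hn (ih (by omega)) (Fin.last r)).bounded.add
        ((h.macroscopic n hn (Fin.last r)).bounded q)).congr ?_
      filter_upwards [h.run] with ε h1 x v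
      rw [h1.kin_succ n hn]
      ring
  exact step n hn (hkin n hn.le) k

end

section

/-! ### The limit scheme -/

variable {r : ℕ} {T : ButcherTableau r}
variable {q : ℕ} {P : ℝ → Compression} {Δt : ℝ} {N : ℕ} {f : ℝ → Field} {R : ℝ → Trajectory r}

/-- The stage values determine the flux derivatives since `A` is invertible. -/
theorem ButcherTableau.IsStifflyAccurateDIRK.solve (hT : T.IsStifflyAccurateDIRK) {Δt : ℝ}
    (hΔt : Δt ≠ 0) {u₀ : State} {u D : Fin (r + 1) → State} :
    (∀ k, u k = u₀ - Δt • ∑ l ∈ Finset.Iic k, T.A k l • D l) ↔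
      ∀ l, D l = ∑ k, T.A⁻¹ l k • (Δt⁻¹ • (u₀ - u k)) := by
  have hsum : ∀ (D : Fin (r + 1) → State) k,
      ∑ l ∈ Finset.Iic k, T.A k l • D l = ∑ l, T.A k l • D l := by
    intro D k
    refine Finset.sum_subset (Finset.subset_univ _) fun l _ hl => ?_
    rw [hT.lower k l (not_le.1 fun h => hl (Finset.mem_Iic.2 h)), zero_smul]
  have hcancel : ∀ {B C : Matrix (Fin (r + 1)) (Fin (r + 1)) ℝ}, B * C = 1 →
      ∀ (D : Fin (r + 1) → State) k, ∑ l, B k l • ∑ m, C l m • D m = D k := by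
    intro B C hBC D k
    simp only [Finset.smul_sum, smul_smul]
    rw [Finset.sum_comm]
    simp only [← Finset.sum_smul, ← Matrix.mul_apply, hBC, Matrix.one_apply, ite_smul, one_smul,
      zero_smul, Finset.sum_ite_eq, Finset.mem_univ, if_true]
  simp only [hsum]
  have hscale : ∀ k, u k = u₀ - Δt • ∑ l, T.A k l • D l ↔
      Δt⁻¹ • (u₀ - u k) = ∑ l, T.A k l • D l := by
    intro k
    rw [inv_smul_eq_iff₀ hΔt, sub_eq_iff_eq_add, eq_sub_iff_add_eq, add_comm (u k), eq_comm]
  simp only [hscale]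
  constructor
  · intro h l
    simp only [h]
    exact (hcancel (Matrix.nonsing_inv_mul _ hT.invertible) D l).symm
  · intro h k
    simp only [h]
    exact (hcancel (Matrix.mul_nonsing_inv _ hT.invertible) (fun k => Δt⁻¹ • (u₀ - u k)) k).symm

theorem tendstoUniformly_sum_smul {ι α β : Type*} {L : Filter ι} (s : Finset β) (c : β → ℝ)
    {F : β → ι → α → State} {G : β → α → State} (h : ∀ b ∈ s, TendstoUniformly (F b) (G b) L) :
    TendstoUniformly (fun i x => ∑ b ∈ s, c b • F b i x) (fun x => ∑ b ∈ s, c b • G b x) L := by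
  classical
  induction s using Finset.induction_on with
  | empty =>
    simp only [Finset.sum_empty]
    exact fun u hu => Eventually.of_forall fun i x => refl_mem_uniformity hu
  | insert a s ha ih =>
    simp only [Finset.sum_insert ha]
    have h1 : TendstoUniformly (fun i x => c a • F a i x) (fun x => c a • G a x) L :=
      (uniformContinuous_const_smul (c a)).comp_tendstoUniformly (h a (by simp))
    exact h1.add (ih fun b hb => h b (by simp [hb]))

theorem limit_mem_of_uniformlyAdmissible {V : ℝ → ℝ → State} (hV : UniformlyAdmissible V)
    {L : Filter ℝ} [L.NeBot] (hL : L ≤ 𝓝[>] 0) {U : ℝ → State}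
    (h : TendstoUniformly V U L) : ∃ S, IsCompact S ∧ S ⊆ admissible ∧ (∀ x, U x ∈ S) ∧
      ∀ᶠ ε in L, ∀ x, V ε x ∈ S := by
  obtain ⟨S, hS, hSΩ, hV⟩ := hV
  have hV' := hV.filter_mono hL
  exact ⟨S, hS, hSΩ, fun x => hS.isClosed.mem_of_tendsto (h.tendsto_at x)
    (hV'.mono fun ε h => h x), hV'⟩

/-- Triangle inequality through `M_{V ε}`: one part is `O(ε)`, the other is controlled by the
Lipschitz bound and the uniform convergence of `V`. -/
theorem tendsto_wnorm_maxwellian {F : ℝ → Field} {V : ℝ → ℝ → State}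
    (hV : UniformlyAdmissible V)
    (hF : FieldBigO q 1 (fun ε x v => F ε x v - localMaxwellian (V ε) x v))
    {L : Filter ℝ} [L.NeBot] (hL : L ≤ 𝓝[>] 0) {U : ℝ → State} (h : TendstoUniformly V U L) :
    Tendsto (fun ε => wnorm q (fun x v => F ε x v - localMaxwellian U x v)) L (𝓝 0) := by
  obtain ⟨S, hS, hSΩ, hUS, hVS⟩ := limit_mem_of_uniformlyAdmissible hV hL h
  obtain ⟨C, hC0, -, hC⟩ := exists_maxwellian_bounds hS hSΩ q
  obtain ⟨D, hD⟩ := hF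
  have key : ∀ η > 0, ∀ᶠ ε in L,
      wnorm q (fun x v => F ε x v - localMaxwellian U x v) ≤ ENNReal.ofReal η := by
    intro η hη
    have h1 : ∀ᶠ ε in L, D * ε ^ 1 < η / 2 := by
      have : Tendsto (fun ε : ℝ => D * ε ^ 1) (𝓝 0) (𝓝 (D * 0 ^ 1)) :=
        (continuous_const.mul (continuous_id.pow 1)).tendsto 0
      rw [zero_pow one_ne_zero, mul_zero] at this
      exact (hL.trans nhdsWithin_le_nhds) (this.eventually (gt_mem_nhds (half_pos hη)))
    have h2 := Metric.tendstoUniformly_iff.1 h (η / (2 * (C + 1))) (by positivity)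
    filter_upwards [h1, h2, hVS, hD.filter_mono hL] with ε h1 h2 h3 h4
    refine wnorm_le_ofReal fun x v => ?_
    have h5 := hC _ (h3 x) _ (hUS x) v
    have h6 : C * ‖V ε x - U x‖ ≤ η / 2 := by
      have h7 := h2 x
      rw [dist_comm, dist_eq_norm, lt_div_iff₀ (by positivity)] at h7
      nlinarith [norm_nonneg (V ε x - U x)]
    have h8 : (1 + |v|) ^ q * |F ε x v - localMaxwellian U x v| ≤
        (1 + |v|) ^ q * |F ε x v - localMaxwellian (V ε) x v| +
        (1 + |v|) ^ q * |maxwellian (V ε x) v - maxwellian (U x) v| := by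
      rw [← mul_add]
      gcongr
      exact abs_sub_le _ _ _
    linarith [h4 x v]
  refine ENNReal.tendsto_nhds_zero.2 fun δ hδ => ?_
  rcases eq_or_ne δ ⊤ with rfl | hδ'
  · simp
  · filter_upwards [key δ.toReal (ENNReal.toReal_pos hδ.ne' hδ')] with ε h1
    rwa [ENNReal.ofReal_toReal hδ'] at h1

theorem continuousAt_eulerFlux {U : State} (hU : U ∈ admissible) : ContinuousAt eulerFlux U := by
  have h0 : U 0 ≠ 0 := hU.1.ne'
  have h : ContinuousAt (fun U : State => (![U 1, 2 * U 2,
      3 * U 1 * U 2 * (U 0)⁻¹ - U 1 ^ 3 * (U 0)⁻¹ ^ 2] : State)) U := by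
    have c : ∀ i, ContinuousAt (fun U : State => U i) U := fun i =>
      (continuous_apply i).continuousAt
    refine continuousAt_pi.2 fun i => ?_
    fin_cases i
    · exact c 1
    · exact continuousAt_const.mul (c 2)
    · exact (((continuousAt_const.mul (c 1)).mul (c 2)).mul ((c 0).inv₀ h0)).sub
        (((c 1).pow 3).mul (((c 0).inv₀ h0).pow 2))
  refine h.congr ?_
  filter_upwards [isOpen_admissible.mem_nhds hU] with V hV using (eulerFlux_eq hV).symm

/-- Applying `A⁻¹` to the stage equations writes each flux derivative as a combination of `(U^n -
U^(k)) / Δt`. These converge uniformly and the fluxes converge pointwise, hence the limit fluxes are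
differentiable with the limit derivatives. Applying `A` again recovers the scheme. -/
theorem AdmissibleRuns.limit_scheme (h : AdmissibleRuns q T P Δt N f R) {n : ℕ} (hn : n < N)
    {L : Filter ℝ} [L.NeBot] (hL : L ≤ 𝓝[>] 0) {U₀ : ℝ → State} {U : Fin (r + 1) → ℝ → State}
    (hU : IsMacroLimit R n L U₀ U) :
    (∀ k, Differentiable ℝ (fun x => eulerFlux (U k x))) ∧
      ∀ k x, U k x = U₀ x -
        Δt • ∑ l ∈ Finset.Iic k, T.A k l • deriv (fun y => eulerFlux (U l y)) x := by
  have hflux : ∀ k x, Tendsto (fun ε => flux ((R ε).stageKin n k) x) L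
      (𝓝 (eulerFlux (U k x))) := by
    intro k x
    obtain ⟨S, -, hSΩ, hUS, -⟩ :=
      limit_mem_of_uniformlyAdmissible (h.macroscopic n hn k) hL (hU.2 k)
    have h1 : Tendsto (fun ε => eulerFlux ((R ε).stageMac n k x)) L (𝓝 (eulerFlux (U k x))) :=
      (continuousAt_eulerFlux (hSΩ (hUS x))).tendsto.comp ((hU.2 k).tendsto_at x)
    obtain ⟨C, hC⟩ := (h.stage_closure hn (h.near_maxwellian hn k)).2
    have h2 : Tendsto (fun ε => flux ((R ε).stageKin n k) x -
        eulerFlux ((R ε).stageMac n k x)) L (𝓝 0) := by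
      have h3 : Tendsto (fun ε : ℝ => C * ε ^ 1) (𝓝 0) (𝓝 (C * 0 ^ 1)) :=
        (continuous_const.mul (continuous_id.pow 1)).tendsto 0
      rw [zero_pow one_ne_zero, mul_zero] at h3
      exact squeeze_zero_norm' ((hC.filter_mono hL).mono fun ε h => h x)
        (h3.mono_left (hL.trans nhdsWithin_le_nhds))
    simpa using h2.add h1
  have hderiv : ∀ l x, HasDerivAt (fun y => eulerFlux (U l y))
      (∑ k, T.A⁻¹ l k • (Δt⁻¹ • (U₀ x - U k x))) x := by
    intro l
    refine hasDerivAt_of_tendstoUniformly (l := L)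
      (f := fun ε => flux ((R ε).stageKin n l))
      (f' := fun ε x => ∑ k, T.A⁻¹ l k • (Δt⁻¹ • ((R ε).mac n x - (R ε).stageMac n k x)))
      ?_ ?_ (hflux l)
    · exact tendstoUniformly_sum_smul _ _ fun k _ =>
        (uniformContinuous_const_smul Δt⁻¹).comp_tendstoUniformly (hU.1.sub (hU.2 k))
    · filter_upwards [h.run.filter_mono hL] with ε h1 x
      have h2 := (h.tableau.solve h.pos.ne').1 (fun k => h1.macroscopic n hn k x) l
      rw [← h2]
      exact (h1.flux_differentiable n hn l x).hasDerivAt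
  refine ⟨fun k x => (hderiv k x).differentiableAt, fun k x => ?_⟩
  exact (h.tableau.solve h.pos.ne').2 (fun l => (hderiv l x).deriv) k

end

/-! ### Families of functions of order `h^m` together with their derivatives -/

section Families

variable {κ : Type*} {h : κ → ℝ} {τ : ℝ}

/-- The functions `a k` are `j` times differentiable, and they and their derivatives up to order `j`
are bounded by a multiple of `(h k)^m`, uniformly in `k`. -/
def SmoothBigO (h : κ → ℝ) (m : ℕ) : ℕ → (κ → ℝ → ℝ) → Prop
  | 0, a => ∃ C, ∀ k x, |a k x| ≤ C * h k ^ m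
  | j + 1, a => (∃ C, ∀ k x, |a k x| ≤ C * h k ^ m) ∧ (∀ k, Differentiable ℝ (a k)) ∧
      SmoothBigO h m j (fun k => deriv (a k))

namespace SmoothBigO

theorem bound {m j : ℕ} {a : κ → ℝ → ℝ} (ha : SmoothBigO h m j a) :
    ∃ C, ∀ k x, |a k x| ≤ C * h k ^ m := by
  cases j with
  | zero => exact ha
  | succ j => exact ha.1

theorem differentiable {m j : ℕ} {a : κ → ℝ → ℝ} (ha : SmoothBigO h m (j + 1) a) (k : κ) :
    Differentiable ℝ (a k) := ha.2.1 k

theorem deriv {m j : ℕ} {a : κ → ℝ → ℝ} (ha : SmoothBigO h m (j + 1) a) :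
    SmoothBigO h m j (fun k => deriv (a k)) := ha.2.2

theorem mono {m j : ℕ} {a : κ → ℝ → ℝ} (ha : SmoothBigO h m (j + 1) a) : SmoothBigO h m j a := by
  induction j generalizing a with
  | zero => exact ha.bound
  | succ j ih => exact ⟨ha.bound, ha.differentiable, ih ha.deriv⟩

theorem of_order_le {m j n : ℕ} {a : κ → ℝ → ℝ} (ha : SmoothBigO h m n a) (hjn : j ≤ n) :
    SmoothBigO h m j a := by
  induction n, hjn using Nat.le_induction with
  | base => exact ha
  | succ n _ ih => exact ih ha.mono

theorem congr {m j : ℕ} {a b : κ → ℝ → ℝ} (ha : SmoothBigO h m j a)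
    (hab : ∀ k x, b k x = a k x) : SmoothBigO h m j b := by
  rwa [show b = a from funext fun k => funext (hab k)]

theorem comp {κ' : Type*} (π : κ' → κ) {m j : ℕ} {a : κ → ℝ → ℝ} (ha : SmoothBigO h m j a) :
    SmoothBigO (fun k => h (π k)) m j (fun k => a (π k)) := by
  induction j generalizing a with
  | zero => obtain ⟨C, hC⟩ := ha; exact ⟨C, fun k => hC (π k)⟩
  | succ j ih =>
    obtain ⟨⟨C, hC⟩, h1, h2⟩ := ha
    exact ⟨⟨C, fun k => hC (π k)⟩, fun k => h1 (π k), ih h2⟩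

theorem add {m j : ℕ} {a b : κ → ℝ → ℝ} (ha : SmoothBigO h m j a) (hb : SmoothBigO h m j b) :
    SmoothBigO h m j (fun k x => a k x + b k x) := by
  have h0 : ∀ {i : ℕ} {a b : κ → ℝ → ℝ}, SmoothBigO h m i a → SmoothBigO h m i b →
      ∃ C, ∀ k x, |a k x + b k x| ≤ C * h k ^ m := by
    intro i a b ha hb
    obtain ⟨C, hC⟩ := ha.bound
    obtain ⟨D, hD⟩ := hb.bound
    exact ⟨C + D, fun k x => (abs_add_le _ _).trans (by linarith [hC k x, hD k x])⟩
  induction j generalizing a b with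
  | zero => exact h0 ha hb
  | succ j ih =>
    exact ⟨h0 ha hb, fun k => (ha.differentiable k).add (hb.differentiable k),
      (ih ha.deriv hb.deriv).congr fun k x =>
        deriv_fun_add (ha.differentiable k x) (hb.differentiable k x)⟩

theorem zero (h : κ → ℝ) (m j : ℕ) : SmoothBigO h m j (fun _ _ => 0) := by
  induction j with
  | zero => exact ⟨0, by simp⟩
  | succ j ih => exact ⟨⟨0, by simp⟩, fun k => differentiable_const _, by simpa using ih⟩

/-- Multiplication by coefficients of order `h^n` that do not depend on `x`. -/
theorem smul {m n j : ℕ} {a : κ → ℝ → ℝ} (ha : SmoothBigO h m j a) {c : κ → ℝ} {D : ℝ}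
    (hc : ∀ k, |c k| ≤ D * h k ^ n) : SmoothBigO h (m + n) j (fun k x => c k * a k x) := by
  have h0 : ∀ {a : κ → ℝ → ℝ}, (∃ C, ∀ k x, |a k x| ≤ C * h k ^ m) →
      ∃ C, ∀ k x, |c k * a k x| ≤ C * h k ^ (m + n) := by
    rintro a ⟨C, hC⟩
    refine ⟨D * C, fun k x => ?_⟩
    rw [abs_mul, pow_add]
    calc |c k| * |a k x| ≤ (D * h k ^ n) * (C * h k ^ m) :=
          mul_le_mul (hc k) (hC k x) (abs_nonneg _) ((abs_nonneg _).trans (hc k))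
      _ = _ := by ring
  induction j generalizing a with
  | zero => exact h0 ha
  | succ j ih =>
    refine ⟨h0 ha.bound, fun k => (ha.differentiable k).const_mul _, ?_⟩
    exact (ih ha.deriv).congr fun k x => deriv_const_mul _ (ha.differentiable k x)

theorem const_mul {m j : ℕ} {a : κ → ℝ → ℝ} (ha : SmoothBigO h m j a) (c : ℝ) :
    SmoothBigO h m j (fun k x => c * a k x) :=
  ha.smul (n := 0) (c := fun _ => c) (D := |c|) (by simp)

theorem sub {m j : ℕ} {a b : κ → ℝ → ℝ} (ha : SmoothBigO h m j a) (hb : SmoothBigO h m j b) :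
    SmoothBigO h m j (fun k x => a k x - b k x) :=
  (ha.add (hb.const_mul (-1))).congr fun k x => by ring

theorem sum {ι : Type*} (s : Finset ι) {m j : ℕ} {a : ι → κ → ℝ → ℝ}
    (ha : ∀ i ∈ s, SmoothBigO h m j (a i)) :
    SmoothBigO h m j (fun k x => ∑ i ∈ s, a i k x) := by
  classical
  induction s using Finset.induction_on with
  | empty => simpa using zero h m j
  | insert i s hi ih =>
    simp only [Finset.sum_insert hi]
    exact (ha i (by simp)).add (ih fun l hl => ha l (by simp [hl]))

theorem mul {m n j : ℕ} {a b : κ → ℝ → ℝ} (ha : SmoothBigO h m j a) (hb : SmoothBigO h n j b) :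
    SmoothBigO h (m + n) j (fun k x => a k x * b k x) := by
  have h0 : ∀ {i : ℕ} {a b : κ → ℝ → ℝ}, SmoothBigO h m i a → SmoothBigO h n i b →
      ∃ C, ∀ k x, |a k x * b k x| ≤ C * h k ^ (m + n) := by
    intro i a b ha hb
    obtain ⟨C, hC⟩ := ha.bound
    obtain ⟨D, hD⟩ := hb.bound
    refine ⟨C * D, fun k x => ?_⟩
    rw [abs_mul, pow_add]
    calc |a k x| * |b k x| ≤ (C * h k ^ m) * (D * h k ^ n) :=
          mul_le_mul (hC k x) (hD k x) (abs_nonneg _) ((abs_nonneg _).trans (hC k x))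
      _ = _ := by ring
  induction j generalizing a b with
  | zero => exact h0 ha hb
  | succ j ih =>
    exact ⟨h0 ha hb, fun k => (ha.differentiable k).mul (hb.differentiable k),
      ((ih ha.deriv hb.mono).add (ih ha.mono hb.deriv)).congr fun k x =>
        deriv_fun_mul (ha.differentiable k x) (hb.differentiable k x)⟩

theorem of_le {m n j : ℕ} {a : κ → ℝ → ℝ} (hh : ∀ k, 0 ≤ h k ∧ h k ≤ τ)
    (ha : SmoothBigO h n j a) (hmn : m ≤ n) : SmoothBigO h m j a := by
  have h0 : ∀ {a : κ → ℝ → ℝ}, (∃ C, ∀ k x, |a k x| ≤ C * h k ^ n) →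
      ∃ C, ∀ k x, |a k x| ≤ C * h k ^ m := by
    rintro a ⟨C, hC⟩
    refine ⟨|C| * τ ^ (n - m), fun k x => (hC k x).trans ?_⟩
    have h1 := (hh k).1
    calc C * h k ^ n = C * (h k ^ (n - m) * h k ^ m) := by
          rw [← pow_add, Nat.sub_add_cancel hmn]
      _ ≤ |C| * (τ ^ (n - m) * h k ^ m) := by
          gcongr
          · exact le_abs_self C
          · exact (hh k).2
      _ = _ := by ring
  induction j generalizing a with
  | zero => exact h0 ha
  | succ j ih => exact ⟨h0 ha.bound, ha.differentiable, ih ha.deriv⟩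

/-- Induction on the number of derivatives through `(1/a)' = -a' (1/a)²`, whose right side involves
`1/a` with one derivative less. -/
theorem inv {j : ℕ} {a : κ → ℝ → ℝ} (ha : SmoothBigO h 0 j a) {δ : ℝ} (hδ : 0 < δ)
    (hl : ∀ k x, δ ≤ a k x) : SmoothBigO h 0 j (fun k x => (a k x)⁻¹) := by
  have h0 : ∃ C, ∀ k x, |(a k x)⁻¹| ≤ C * h k ^ 0 := by
    refine ⟨δ⁻¹, fun k x => ?_⟩
    rw [pow_zero, mul_one, abs_inv, abs_of_pos (hδ.trans_le (hl k x))]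
    exact inv_anti₀ hδ (hl k x)
  induction j with
  | zero => exact h0
  | succ j ih =>
    have hne : ∀ k x, a k x ≠ 0 := fun k x => (hδ.trans_le (hl k x)).ne'
    refine ⟨h0, fun k x => (ha.differentiable k x).inv (hne k x), ?_⟩
    have h1 := ih ha.mono
    exact ((ha.deriv.mul (h1.mul h1)).const_mul (-1)).congr fun k x => by
      rw [deriv_fun_inv'' (ha.differentiable k x) (hne k x)]
      field_simp

theorem of_iteratedDeriv {n : ℕ} {a : κ → ℝ → ℝ} (hc : ∀ k, ContDiff ℝ n (a k)) {C : ℝ}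
    (hC : ∀ k, ∀ l ≤ n, ∀ x, |iteratedDeriv l (a k) x| ≤ C) : SmoothBigO h 0 n a := by
  induction n generalizing a with
  | zero => exact ⟨C, fun k x => by simpa using hC k 0 le_rfl x⟩
  | succ n ih =>
    refine ⟨⟨C, fun k x => by simpa using hC k 0 (by omega) x⟩,
      fun k => (hc k).differentiable (by simp), ih (fun k => ?_) fun k l hl x => ?_⟩
    · have := hc k
      push_cast at this
      exact (contDiff_succ_iff_deriv.1 this).2.2
    · rw [← iteratedDeriv_succ']
      exact hC k (l + 1) (by omega) x

end SmoothBigO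

theorem SmoothState.smoothBigO {n : ℕ} {K : ℝ} {U : κ → ℝ → State}
    (hU : ∀ k, SmoothState n K (U k)) (i : Fin 3) : SmoothBigO h 0 n (fun k x => U k x i) := by
  refine SmoothBigO.of_iteratedDeriv (C := K) (fun k => contDiff_pi.1 (hU k).contDiff i)
    fun k l hl x => ?_
  have h1 : iteratedDeriv l (fun x => U k x i) x = iteratedDeriv l (U k) x i := by
    have hc : ∀ l ≤ n, ∀ x, iteratedDeriv l (fun x => U k x i) x = iteratedDeriv l (U k) x i := by
      intro l
      induction l with
      | zero => intro _ x; simp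
      | succ l ih =>
        intro hl x
        rw [iteratedDeriv_succ, iteratedDeriv_succ, funext (ih (by omega))]
        have hd : DifferentiableAt ℝ (iteratedDeriv l (U k)) x :=
          ((hU k).contDiff.differentiable_iteratedDeriv l (by exact_mod_cast hl)) x
        exact ((hasDerivAt_pi.1 hd.hasDerivAt) i).deriv
    exact hc l hl x
  rw [h1]
  exact (norm_le_pi_norm (iteratedDeriv l (U k) x) i).trans ((hU k).bound l hl x)

/-! ### Second-order expansions -/

/-- The coefficients of an expansion `z₀ + c h z₁ + d h² z₂ + c² h² z₃`. -/
structure Jet where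
  z₀ : ℝ → ℝ
  z₁ : ℝ → ℝ
  z₂ : ℝ → ℝ
  z₃ : ℝ → ℝ

namespace Jet

def val (c d h : ℝ) (J : Jet) (x : ℝ) : ℝ :=
  J.z₀ x + c * h * J.z₁ x + d * h ^ 2 * J.z₂ x + c ^ 2 * h ^ 2 * J.z₃ x

/-- Product truncated at `h³`; the square of the `c h` terms is what makes a separate `c² h²`
coefficient necessary. -/
def mul (J K : Jet) : Jet where
  z₀ x := J.z₀ x * K.z₀ x
  z₁ x := J.z₀ x * K.z₁ x + J.z₁ x * K.z₀ x
  z₂ x := J.z₀ x * K.z₂ x + J.z₂ x * K.z₀ x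
  z₃ x := J.z₀ x * K.z₃ x + J.z₃ x * K.z₀ x + J.z₁ x * K.z₁ x

def combine (a b : ℝ) (J K : Jet) : Jet where
  z₀ x := a * J.z₀ x + b * K.z₀ x
  z₁ x := a * J.z₁ x + b * K.z₁ x
  z₂ x := a * J.z₂ x + b * K.z₂ x
  z₃ x := a * J.z₃ x + b * K.z₃ x

/-- The truncated Neumann series of the reciprocal, chosen so that the truncated product with `J` is
exactly `1` where `J.z₀ ≠ 0`. -/
def inv (J : Jet) : Jet where
  z₀ x := (J.z₀ x)⁻¹
  z₁ x := -(J.z₁ x * ((J.z₀ x)⁻¹ * (J.z₀ x)⁻¹))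
  z₂ x := -(J.z₂ x * ((J.z₀ x)⁻¹ * (J.z₀ x)⁻¹))
  z₃ x := J.z₁ x * J.z₁ x * ((J.z₀ x)⁻¹ * ((J.z₀ x)⁻¹ * (J.z₀ x)⁻¹)) -
    J.z₃ x * ((J.z₀ x)⁻¹ * (J.z₀ x)⁻¹)

def one : Jet := ⟨fun _ => 1, fun _ => 0, fun _ => 0, fun _ => 0⟩

end Jet

/-- The coefficients of a family of expansions are bounded with `j` derivatives. -/
structure SmoothJet (h : κ → ℝ) (j : ℕ) (J : κ → Jet) : Prop where
  z₀ : SmoothBigO h 0 j (fun k => (J k).z₀)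
  z₁ : SmoothBigO h 0 j (fun k => (J k).z₁)
  z₂ : SmoothBigO h 0 j (fun k => (J k).z₂)
  z₃ : SmoothBigO h 0 j (fun k => (J k).z₃)

/-- `z = z₀ + c h z₁ + d h² z₂ + c² h² z₃ + O(h^m)` with `j` derivatives. -/
structure HasJet (h c d : κ → ℝ) (m j : ℕ) (z : κ → ℝ → ℝ) (J : κ → Jet) : Prop where
  smooth : SmoothJet h j J
  remainder : SmoothBigO h m j (fun k x => z k x - (J k).val (c k) (d k) (h k) x)

theorem smoothBigO_const (h : κ → ℝ) (j : ℕ) (a : ℝ) : SmoothBigO h 0 j (fun _ _ => a) := by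
  induction j with
  | zero => exact ⟨|a|, by simp⟩
  | succ j _ =>
    exact ⟨⟨|a|, by simp⟩, fun k => differentiable_const _, by simpa using SmoothBigO.zero h 0 j⟩

variable {c d : κ → ℝ} {D : ℝ}

namespace SmoothJet

variable {j : ℕ} {J K : κ → Jet}

theorem mul (hJ : SmoothJet h j J) (hK : SmoothJet h j K) :
    SmoothJet h j (fun k => (J k).mul (K k)) where
  z₀ := hJ.z₀.mul hK.z₀
  z₁ := (hJ.z₀.mul hK.z₁).add (hJ.z₁.mul hK.z₀)
  z₂ := (hJ.z₀.mul hK.z₂).add (hJ.z₂.mul hK.z₀)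
  z₃ := ((hJ.z₀.mul hK.z₃).add (hJ.z₃.mul hK.z₀)).add (hJ.z₁.mul hK.z₁)

theorem combine (hJ : SmoothJet h j J) (hK : SmoothJet h j K) (a b : ℝ) :
    SmoothJet h j (fun k => (J k).combine a b (K k)) where
  z₀ := (hJ.z₀.const_mul a).add (hK.z₀.const_mul b)
  z₁ := (hJ.z₁.const_mul a).add (hK.z₁.const_mul b)
  z₂ := (hJ.z₂.const_mul a).add (hK.z₂.const_mul b)
  z₃ := (hJ.z₃.const_mul a).add (hK.z₃.const_mul b)

theorem inv (hJ : SmoothJet h j J) {δ : ℝ} (hδ : 0 < δ) (hl : ∀ k x, δ ≤ (J k).z₀ x) :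
    SmoothJet h j (fun k => (J k).inv) := by
  have h1 := hJ.z₀.inv hδ hl
  exact
    { z₀ := h1
      z₁ := ((hJ.z₁.mul (h1.mul h1)).const_mul (-1)).congr fun k x => by simp [Jet.inv]
      z₂ := ((hJ.z₂.mul (h1.mul h1)).const_mul (-1)).congr fun k x => by simp [Jet.inv]
      z₃ := ((hJ.z₁.mul hJ.z₁).mul (h1.mul (h1.mul h1))).sub (hJ.z₃.mul (h1.mul h1)) }

theorem val (hh : ∀ k, 0 ≤ h k ∧ h k ≤ τ) (hc : ∀ k, |c k| ≤ D) (hd : ∀ k, |d k| ≤ D)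
    (hJ : SmoothJet h j J) :
    SmoothBigO h 0 j (fun k => (J k).val (c k) (d k) (h k)) := by
  have hD : ∀ k, 0 ≤ D := fun k => (abs_nonneg _).trans (hc k)
  have h1 : ∀ k, |c k * h k| ≤ D * h k ^ 1 := fun k => by
    rw [abs_mul, abs_of_nonneg (hh k).1, pow_one]
    exact mul_le_mul_of_nonneg_right (hc k) (hh k).1
  have h2 : ∀ k, |d k * h k ^ 2| ≤ D * h k ^ 2 := fun k => by
    rw [abs_mul, abs_of_nonneg (pow_nonneg (hh k).1 2)]
    exact mul_le_mul_of_nonneg_right (hd k) (pow_nonneg (hh k).1 2)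
  have h3 : ∀ k, |c k ^ 2 * h k ^ 2| ≤ D ^ 2 * h k ^ 2 := fun k => by
    rw [abs_mul, abs_of_nonneg (pow_nonneg (hh k).1 2), abs_pow]
    have := (hh k).1
    gcongr
    exact hc k
  exact ((hJ.z₀.add ((hJ.z₁.smul h1).of_le hh (by simp))).add
    ((hJ.z₂.smul h2).of_le hh (by simp))).add ((hJ.z₃.smul h3).of_le hh (by simp))

end SmoothJet

namespace HasJet

variable {m j : ℕ} {z w : κ → ℝ → ℝ} {J K : κ → Jet}

theorem congr (hz : HasJet h c d m j z J) (e : ∀ k x, w k x = z k x) : HasJet h c d m j w J :=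
  ⟨hz.smooth, hz.remainder.congr fun k x => by rw [e]⟩

theorem bounded (hh : ∀ k, 0 ≤ h k ∧ h k ≤ τ) (hc : ∀ k, |c k| ≤ D) (hd : ∀ k, |d k| ≤ D)
    (hz : HasJet h c d m j z J) : SmoothBigO h 0 j z :=
  ((hz.remainder.of_le hh (Nat.zero_le m)).add (hz.smooth.val hh hc hd)).congr
    fun k x => by ring

theorem combine (hz : HasJet h c d m j z J) (hw : HasJet h c d m j w K) (a b : ℝ) :
    HasJet h c d m j (fun k x => a * z k x + b * w k x) (fun k => (J k).combine a b (K k)) :=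
  ⟨hz.smooth.combine hw.smooth a b,
    ((hz.remainder.const_mul a).add (hw.remainder.const_mul b)).congr fun k x => by
      simp only [Jet.val, Jet.combine]; ring⟩

/-- The cross terms dropped by `Jet.mul` carry `h³` or `h⁴`, so for `m ≤ 3` and bounded `h` they
belong to the remainder. -/
theorem mul (hm : m ≤ 3) (hh : ∀ k, 0 ≤ h k ∧ h k ≤ τ) (hc : ∀ k, |c k| ≤ D)
    (hd : ∀ k, |d k| ≤ D) (hz : HasJet h c d m j z J) (hw : HasJet h c d m j w K) :
    HasJet h c d m j (fun k x => z k x * w k x) (fun k => (J k).mul (K k)) := by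
  have hJ := hz.smooth
  have hK := hw.smooth
  refine ⟨hJ.mul hK, ?_⟩
  have coef : ∀ {e : κ → ℝ} {E : ℝ} {n : ℕ} {a : κ → ℝ → ℝ}, (∀ k, |e k| ≤ E) → 3 ≤ n →
      SmoothBigO h 0 j a → SmoothBigO h m j (fun k x => (e k * h k ^ n) * a k x) := by
    intro e E n a he hn ha
    refine (ha.smul (n := n) (D := E) fun k => ?_).of_le hh (by omega)
    rw [abs_mul, abs_of_nonneg (pow_nonneg (hh k).1 n)]
    exact mul_le_mul_of_nonneg_right (he k) (pow_nonneg (hh k).1 n)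
  have bmul : ∀ {e e' : κ → ℝ} {E E' : ℝ}, (∀ k, |e k| ≤ E) → (∀ k, |e' k| ≤ E') →
      ∀ k, |e k * e' k| ≤ E * E' := by
    intro e e' E E' he he' k
    rw [abs_mul]
    exact mul_le_mul (he k) (he' k) (abs_nonneg _) ((abs_nonneg _).trans (he k))
  have r1 := hz.remainder.mul (hw.bounded hh hc hd)
  have r2 := (hJ.val hh hc hd).mul hw.remainder
  rw [zero_add] at r2
  -- The five groups of dropped terms have coefficients `c d h³`, `c³ h³`, `d² h⁴`, `d c² h⁴` and
  -- `c⁴ h⁴`.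
  have t1 := coef (bmul hc hd) le_rfl ((hJ.z₁.mul hK.z₂).add (hJ.z₂.mul hK.z₁))
  have t2 := coef (bmul hc (bmul hc hc)) le_rfl ((hJ.z₁.mul hK.z₃).add (hJ.z₃.mul hK.z₁))
  have t3 := coef (bmul hd hd) (Nat.le_succ 3) (hJ.z₂.mul hK.z₂)
  have t4 := coef (bmul hd (bmul hc hc)) (Nat.le_succ 3)
    ((hJ.z₂.mul hK.z₃).add (hJ.z₃.mul hK.z₂))
  have t5 := coef (bmul (bmul hc hc) (bmul hc hc)) (Nat.le_succ 3) (hJ.z₃.mul hK.z₃)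
  exact (((((((r1.add r2).add t1).add t2).add t3).add t4).add t5)).congr fun k x => by
    simp only [Jet.val, Jet.mul]; ring

theorem of_smooth (hJ : SmoothJet h j J) :
    HasJet h c d m j (fun k => (J k).val (c k) (d k) (h k)) J :=
  ⟨hJ, (SmoothBigO.zero h m j).congr fun k x => by simp⟩

/-- With `s` the value of the inverse jet, `1/z - s = -(1/z) (z s - 1)`; the product rule for jets
makes `z s - 1` of order `h^m`. -/
theorem inv (hm : m ≤ 3) (hh : ∀ k, 0 ≤ h k ∧ h k ≤ τ) (hc : ∀ k, |c k| ≤ D)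
    (hd : ∀ k, |d k| ≤ D) (hz : HasJet h c d m j z J) {δ : ℝ} (hδ : 0 < δ)
    (hl : ∀ k x, δ ≤ z k x) (hl' : ∀ k x, δ ≤ (J k).z₀ x) :
    HasJet h c d m j (fun k x => (z k x)⁻¹) (fun k => (J k).inv) := by
  have hi := hz.smooth.inv hδ hl'
  refine ⟨hi, ?_⟩
  have h1 := hz.mul hm hh hc hd (of_smooth (m := m) (c := c) (d := d) hi)
  have h2 := ((hz.bounded hh hc hd).inv hδ hl).mul (h1.remainder.const_mul (-1))
  rw [zero_add] at h2
  refine h2.congr fun k x => ?_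
  have hne : z k x ≠ 0 := (hδ.trans_le (hl k x)).ne'
  have hne' : (J k).z₀ x ≠ 0 := (hδ.trans_le (hl' k x)).ne'
  have e : ((J k).mul (J k).inv).val (c k) (d k) (h k) x = 1 := by
    simp only [Jet.val, Jet.mul, Jet.inv]
    field_simp
    ring
  rw [e]
  field_simp
  ring

end HasJet

end Families

/-! ### Expansions of solutions of (discretized) Euler equations -/

/-- The expansion of the Euler flux. -/
def fluxJet (J : Fin 3 → Jet) : Fin 3 → Jet :=
  ![(J 1).combine 1 0 Jet.one, (J 2).combine 2 0 Jet.one,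
    (((J 1).mul (J 2)).mul (J 0).inv).combine 3 (-1)
      (((J 1).mul ((J 1).mul (J 1))).mul ((J 0).inv.mul (J 0).inv))]

section

variable {κ ι : Type*} {h c d : κ → ℝ} {τ D : ℝ} {m j : ℕ}

theorem HasJet.one : HasJet h c d m j (fun _ _ => 1) (fun _ => Jet.one) :=
  ⟨⟨smoothBigO_const h j 1, SmoothBigO.zero h 0 j, SmoothBigO.zero h 0 j,
    SmoothBigO.zero h 0 j⟩, (SmoothBigO.zero h m j).congr fun k x => by simp [Jet.val, Jet.one]⟩

/-- On admissible states the flux is rational with powers of the density as only denominators, so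
products, combinations and one reciprocal suffice. -/
theorem HasJet.eulerFlux (hm : m ≤ 3) (hh : ∀ k, 0 ≤ h k ∧ h k ≤ τ) (hc : ∀ k, |c k| ≤ D)
    (hd : ∀ k, |d k| ≤ D) {y : κ → ℝ → State} {J : κ → Fin 3 → Jet}
    (hy : ∀ i, HasJet h c d m j (fun k x => y k x i) (fun k => J k i))
    (hadm : ∀ k x, y k x ∈ admissible) {δ : ℝ} (hδ : 0 < δ) (hl : ∀ k x, δ ≤ y k x 0)
    (hl' : ∀ k x, δ ≤ (J k 0).z₀ x) (i : Fin 3) :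
    HasJet h c d m j (fun k x => eulerFlux (y k x) i) (fun k => fluxJet (J k) i) := by
  have hσ := (hy 0).inv hm hh hc hd hδ hl hl'
  fin_cases i
  · exact ((hy 1).combine HasJet.one 1 0).congr fun k x => by
      simp [eulerFlux_eq (hadm k x)]
  · exact ((hy 2).combine HasJet.one 2 0).congr fun k x => by
      simp [eulerFlux_eq (hadm k x)]
  · have h1 := ((hy 1).mul hm hh hc hd (hy 2)).mul hm hh hc hd hσ
    have h2 := ((hy 1).mul hm hh hc hd ((hy 1).mul hm hh hc hd (hy 1))).mul hm hh hc hd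
      (hσ.mul hm hh hc hd hσ)
    exact (h1.combine h2 3 (-1)).congr fun k x => by
      simp [eulerFlux_eq (hadm k x)]; ring

/-- The expansion of the solution at order `m`, obtained from the initial state by Picard
iteration. -/
def solutionJet (u : ℝ → State) : ℕ → Fin 3 → Jet
  | 0 => fun i => ⟨fun x => u x i, fun _ => 0, fun _ => 0, fun _ => 0⟩
  -- Integration turns `1, c` into `c, d`. The terms with `d` and `c²` acquire a factor `h³` and go
  -- to the remainder, so the last coefficient is zero.
  | m + 1 => fun i => ⟨fun x => u x i,
      fun x => -deriv (fluxJet (solutionJet u m) i).z₀ x,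
      fun x => -deriv (fluxJet (solutionJet u m) i).z₁ x, fun _ => 0⟩

theorem solutionJet_z₀ (u : ℝ → State) (m : ℕ) (i : Fin 3) (x : ℝ) :
    (solutionJet u m i).z₀ x = u x i := by
  cases m <;> rfl

/-- The result of one application of the integration rule to the flux expansion `G`. -/
def integratedVal (c d e g h : ℝ) (y₀ : ℝ) (G : Jet) (x : ℝ) : ℝ :=
  y₀ - (h * c * deriv G.z₀ x + h ^ 2 * d * deriv G.z₁ x + h ^ 3 * e * deriv G.z₂ x +
    h ^ 3 * g * deriv G.z₃ x)

/-- `y` solves `y = y₀ - h ∫ ∂ₓ F(y)`, where `∫` stands for a quadrature rule that maps the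
coefficients `1, c, d, c²` to `c, d, e, g`. The flux expansions are indexed by the initial data, on
which `y k` depends through `π k`. -/
def Integrates (n : ℕ) (π : κ → ι) (h : ι → ℝ) (c d e g : κ → ℝ) (y : κ → ℝ → State)
    (y₀ : ι → ℝ → State) : Prop :=
  ∀ m j (G : ι → Jet) (i : Fin 3), j ≤ n →
    HasJet (fun k => h (π k)) c d m (j + 1) (fun k x => eulerFlux (y k x) i)
      (fun k => G (π k)) →
    SmoothBigO (fun k => h (π k)) (m + 1) j (fun k x => y k x i -
      integratedVal (c k) (d k) (e k) (g k) (h (π k)) (y₀ (π k) x i) (G (π k)) x)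

variable {h : ι → ℝ} {e g : κ → ℝ} {π : κ → ι} {y : κ → ℝ → State} {y₀ : ι → ℝ → State} {p : ℕ}

/-- Bootstrap in `m`: expand the flux of the current expansion, then integrate. Each round gains a
power of `h` and spends a space derivative, whence the invariant `m + j = p + 1`. The `h³` terms fit
into the remainder because `m + 1 ≤ 3`. -/
theorem Integrates.hasJet (hp : p ≤ 3) (hh : ∀ i, 0 ≤ h i ∧ h i ≤ τ) (hc : ∀ k, |c k| ≤ D)
    (hd : ∀ k, |d k| ≤ D) (he : ∀ k, |e k| ≤ D) (hg : ∀ k, |g k| ≤ D)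
    (hI : Integrates p π h c d e g y y₀)
    (hy : ∀ i, SmoothBigO (fun k => h (π k)) 0 (p + 1) (fun k x => y k x i))
    (hy₀ : ∀ i, SmoothBigO (fun k => h (π k)) 0 (p + 1) (fun k x => y₀ (π k) x i))
    (hadm : ∀ k x, y k x ∈ admissible) {δ : ℝ} (hδ : 0 < δ) (hl : ∀ k x, δ ≤ y k x 0)
    (hl' : ∀ k x, δ ≤ y₀ k x 0) (hmj : m + j = p + 1) (hm : m ≤ p) (i : Fin 3) :
    HasJet (fun k => h (π k)) c d m j (fun k x => y k x i)
      (fun k => solutionJet (y₀ (π k)) m i) := by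
  have hh' : ∀ k, 0 ≤ h (π k) ∧ h (π k) ≤ τ := fun k => hh (π k)
  induction m generalizing j i with
  | zero =>
    obtain rfl : j = p + 1 := by omega
    refine ⟨⟨hy₀ i, SmoothBigO.zero _ _ _, SmoothBigO.zero _ _ _, SmoothBigO.zero _ _ _⟩, ?_⟩
    exact ((hy i).sub (hy₀ i)).congr fun k x => by simp [solutionJet, Jet.val]
  | succ m ih =>
    have hF := HasJet.eulerFlux (by omega : m ≤ 3) hh' hc hd
      (fun i => ih (j := j + 1) (by omega) (by omega) i) hadm hδ hl
      (fun k x => by rw [solutionJet_z₀]; exact hl' _ x) i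
    have hs := hF.smooth
    have h1 := hI m j (fun k => fluxJet (solutionJet (y₀ k) m) i) i (by omega) hF
    have hJ : SmoothJet (fun k => h (π k)) j (fun k => solutionJet (y₀ (π k)) (m + 1) i) :=
      ⟨(ih (j := j + 1) (by omega) (by omega) i).smooth.z₀.mono.congr fun k x => by
          rw [solutionJet_z₀, solutionJet_z₀],
        (hs.z₀.deriv.const_mul (-1)).congr fun k x => by simp [solutionJet],
        (hs.z₁.deriv.const_mul (-1)).congr fun k x => by simp [solutionJet],
        SmoothBigO.zero _ _ _⟩
    refine ⟨hJ, ?_⟩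
    have cube : ∀ {a : κ → ℝ}, (∀ k, |a k| ≤ D) →
        ∀ k, |h (π k) ^ 3 * a k| ≤ D * h (π k) ^ 3 := by
      intro a ha k
      rw [abs_mul, mul_comm, abs_of_nonneg (pow_nonneg (hh' k).1 3)]
      exact mul_le_mul_of_nonneg_right (ha k) (pow_nonneg (hh' k).1 3)
    have h2 := (hs.z₂.deriv.smul (cube he)).of_le hh' (by omega : m + 1 ≤ 0 + 3)
    have h3 := (hs.z₃.deriv.smul (cube hg)).of_le hh' (by omega : m + 1 ≤ 0 + 3)
    exact ((h1.sub h2).sub h3).congr fun k x => by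
      simp only [integratedVal, Jet.val, solutionJet]; ring

/-- The expansion of the solution with a remainder of order `h^(p+1)`. -/
theorem Integrates.expansion (hp : p ≤ 3) (hh : ∀ i, 0 ≤ h i ∧ h i ≤ τ)
    (hc : ∀ k, |c k| ≤ D)
    (hd : ∀ k, |d k| ≤ D) (he : ∀ k, |e k| ≤ D) (hg : ∀ k, |g k| ≤ D)
    (hI : Integrates p π h c d e g y y₀)
    (hy : ∀ i, SmoothBigO (fun k => h (π k)) 0 (p + 1) (fun k x => y k x i))
    (hy₀ : ∀ i, SmoothBigO (fun k => h (π k)) 0 (p + 1) (fun k x => y₀ (π k) x i))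
    (hadm : ∀ k x, y k x ∈ admissible) {δ : ℝ} (hδ : 0 < δ) (hl : ∀ k x, δ ≤ y k x 0)
    (hl' : ∀ k x, δ ≤ y₀ k x 0) (i : Fin 3) :
    SmoothJet (fun k => h (π k)) 1 (fun k => fluxJet (solutionJet (y₀ (π k)) p) i) ∧
    ∃ C, ∀ k x, |y k x i - integratedVal (c k) (d k) (e k) (g k) (h (π k)) (y₀ (π k) x i)
      (fluxJet (solutionJet (y₀ (π k)) p) i) x| ≤ C * h (π k) ^ (p + 1) := by
  have hF := HasJet.eulerFlux hp (fun k => hh (π k)) hc hd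
    (fun i => hI.hasJet hp hh hc hd he hg hy hy₀ hadm hδ hl hl' rfl le_rfl i) hadm hδ hl
    (fun k x => by rw [solutionJet_z₀]; exact hl' _ x) i
  exact ⟨hF.smooth, hI p 0 (fun k => fluxJet (solutionJet (y₀ k) p) i) i (Nat.zero_le _) hF⟩

end

theorem deriv_jet_val {G : Jet} {c d h x : ℝ} (h0 : DifferentiableAt ℝ G.z₀ x)
    (h1 : DifferentiableAt ℝ G.z₁ x) (h2 : DifferentiableAt ℝ G.z₂ x)
    (h3 : DifferentiableAt ℝ G.z₃ x) :
    deriv (G.val c d h) x = deriv G.z₀ x + c * h * deriv G.z₁ x + d * h ^ 2 * deriv G.z₂ x +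
      c ^ 2 * h ^ 2 * deriv G.z₃ x :=
  (((h0.hasDerivAt.add (h1.hasDerivAt.const_mul _)).add (h2.hasDerivAt.const_mul _)).add
    (h3.hasDerivAt.const_mul _)).deriv

theorem deriv_component {F : ℝ → State} {x : ℝ} (hF : DifferentiableAt ℝ F x) (i : Fin 3) :
    deriv F x i = deriv (fun y => F y i) x :=
  ((hasDerivAt_pi.1 hF.hasDerivAt) i).deriv.symm

/-! ### The stages of a Runge-Kutta method -/

section Stages

variable {r : ℕ} {T : ButcherTableau r} {ι : Type*} {h : ι → ℝ}

/-- The quadrature rule is multiplication by `A`, which maps `1, c, Ac, c²` to `c, Ac, A(Ac), Ac²`.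
It is applied to the differentiated flux expansion; the prefactor `h` supplies the extra power in
the remainder. -/
theorem integrates_stages (hT : T.IsStifflyAccurateDIRK) (hh : ∀ i, 0 ≤ h i) (n : ℕ)
    {U : ι → Fin (r + 1) → ℝ → State} {U₀ : ι → ℝ → State}
    (hU : ∀ i k, Differentiable ℝ (fun x => eulerFlux (U i k x)))
    (hs : ∀ i k x, U i k x = U₀ i x -
      h i • ∑ l ∈ Finset.Iic k, T.A k l • deriv (fun y => eulerFlux (U i l y)) x) :
    Integrates n (Prod.fst : ι × Fin (r + 1) → ι) h (fun z => T.c z.2)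
      (fun z => ∑ l, T.A z.2 l * T.c l) (fun z => ∑ l, T.A z.2 l * ∑ m, T.A l m * T.c m)
      (fun z => ∑ l, T.A z.2 l * T.c l ^ 2) (fun z => U z.1 z.2) U₀ := by
  intro m j G i _ hF
  have hsum : ∀ (D : Fin (r + 1) → ℝ) k,
      ∑ l ∈ Finset.Iic k, T.A k l * D l = ∑ l, T.A k l * D l := by
    intro D k
    refine Finset.sum_subset (Finset.subset_univ _) fun l _ hl => ?_
    rw [hT.lower k l (not_le.1 fun h => hl (Finset.mem_Iic.2 h)), zero_mul]
  -- The flux remainder at stage `l`, read as a family over all pairs of a step and a target stage.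
  have h1 : ∀ l, SmoothBigO (fun z : ι × Fin (r + 1) => h z.1) m j (fun z x => T.A z.2 l *
      deriv (fun x => eulerFlux (U z.1 l x) i - (G z.1).val (T.c l)
        (∑ m, T.A l m * T.c m) (h z.1) x) x) := by
    intro l
    obtain ⟨B, hB⟩ : ∃ B, ∀ k, |T.A k l| ≤ B :=
      (Set.finite_range fun k => |T.A k l|).bddAbove.imp fun B hB k => hB ⟨k, rfl⟩
    exact ((hF.remainder.deriv.comp (fun z : ι × Fin (r + 1) => (z.1, l))).smul (n := 0)
      (c := fun z => T.A z.2 l) (D := B) (fun z => by simpa using hB z.2))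
  have h2 := ((SmoothBigO.sum Finset.univ fun l _ => h1 l).smul (n := 1)
    (c := fun z => -h z.1) (D := 1) (fun z => ?_))
  · refine h2.congr ?_
    rintro ⟨a, k⟩ x
    have hG0 := (hF.smooth.z₀.differentiable (a, k)) x
    have hG1 := (hF.smooth.z₁.differentiable (a, k)) x
    have hG2 := (hF.smooth.z₂.differentiable (a, k)) x
    have hG3 := (hF.smooth.z₃.differentiable (a, k)) x
    have e1 : ∀ l, deriv (fun x => eulerFlux (U a l x) i - (G a).val (T.c l)
        (∑ m, T.A l m * T.c m) (h a) x) x = deriv (fun y => eulerFlux (U a l y)) x i -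
        (deriv (G a).z₀ x + T.c l * h a * deriv (G a).z₁ x +
          (∑ m, T.A l m * T.c m) * h a ^ 2 * deriv (G a).z₂ x +
          T.c l ^ 2 * h a ^ 2 * deriv (G a).z₃ x) := by
      intro l
      rw [deriv_component (hU a l x), ← deriv_jet_val hG0 hG1 hG2 hG3]
      refine deriv_fun_sub ?_ ?_
      · exact (hasDerivAt_pi.1 (hU a l x).hasDerivAt i).differentiableAt
      · exact (((hG0.add (hG1.const_mul _)).add (hG2.const_mul _)).add (hG3.const_mul _))
    have e2 : U a k x i = U₀ a x i -
        h a * ∑ l, T.A k l * deriv (fun y => eulerFlux (U a l y)) x i := by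
      rw [hs a k x, ← hsum]
      simp [Finset.sum_apply]
    simp only [e1, e2, integratedVal, hT.row_sum k, mul_sub, mul_add, Finset.sum_sub_distrib,
      Finset.sum_add_distrib]
    have s0 : ∑ l, T.A k l * deriv (G a).z₀ x = (∑ l, T.A k l) * deriv (G a).z₀ x := by
      rw [Finset.sum_mul]
    have s1 : ∑ l, T.A k l * (T.c l * h a * deriv (G a).z₁ x) =
        (∑ l, T.A k l * T.c l) * h a * deriv (G a).z₁ x := by
      simp only [Finset.sum_mul, mul_assoc]
    have s2 : ∑ l, T.A k l * ((∑ m, T.A l m * T.c m) * h a ^ 2 * deriv (G a).z₂ x) =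
        (∑ l, T.A k l * ∑ m, T.A l m * T.c m) * h a ^ 2 * deriv (G a).z₂ x := by
      rw [Finset.sum_mul, Finset.sum_mul]
      exact Finset.sum_congr rfl fun l _ => by ring
    have s3 : ∑ l, T.A k l * (T.c l ^ 2 * h a ^ 2 * deriv (G a).z₃ x) =
        (∑ l, T.A k l * T.c l ^ 2) * h a ^ 2 * deriv (G a).z₃ x := by
      simp only [Finset.sum_mul, mul_assoc]
    rw [s0, s1, s2, s3]
    ring
  · rw [abs_neg, abs_of_nonneg (hh z.1)]; simp

end Stages

/-! ### Exact solutions -/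

/-- On `[0, h]`, `g` is the time derivative of `w`, also after up to `j` derivatives in space. -/
def MixedDeriv (h : ℝ) : ℕ → (ℝ → ℝ → ℝ) → (ℝ → ℝ → ℝ) → Prop
  | 0, w, g => ∀ t ∈ Set.Icc 0 h, ∀ x, HasDerivWithinAt (fun s => w s x) (g t x) (Set.Icc 0 h) t
  | j + 1, w, g =>
    (∀ t ∈ Set.Icc 0 h, ∀ x, HasDerivWithinAt (fun s => w s x) (g t x) (Set.Icc 0 h) t) ∧
    (∀ t ∈ Set.Icc 0 h, Differentiable ℝ (w t) ∧ Differentiable ℝ (g t)) ∧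
    MixedDeriv h j (fun t => deriv (w t)) (fun t => deriv (g t))

namespace MixedDeriv

variable {h : ℝ}

theorem hasDerivWithinAt {j : ℕ} {w g : ℝ → ℝ → ℝ} (hw : MixedDeriv h j w g) {t : ℝ}
    (ht : t ∈ Set.Icc 0 h) (x : ℝ) :
    HasDerivWithinAt (fun s => w s x) (g t x) (Set.Icc 0 h) t := by
  cases j with
  | zero => exact hw t ht x
  | succ j => exact hw.1 t ht x

theorem congr {j : ℕ} {w w' g g' : ℝ → ℝ → ℝ} (hw : MixedDeriv h j w g)
    (hww : ∀ t ∈ Set.Icc 0 h, w' t = w t) (hgg : ∀ t ∈ Set.Icc 0 h, g' t = g t) :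
    MixedDeriv h j w' g' := by
  have h0 : ∀ t ∈ Set.Icc 0 h, ∀ x,
      HasDerivWithinAt (fun s => w' s x) (g' t x) (Set.Icc 0 h) t := by
    intro t ht x
    rw [hgg t ht]
    exact (hw.hasDerivWithinAt ht x).congr (fun s hs => by rw [hww s hs]) (by rw [hww t ht])
  induction j generalizing w w' g g' with
  | zero => exact h0
  | succ j ih =>
    have hw1 : ∀ t ∈ Set.Icc 0 h, deriv (w' t) = deriv (w t) := fun t ht => by rw [hww t ht]
    have hg1 : ∀ t ∈ Set.Icc 0 h, deriv (g' t) = deriv (g t) := fun t ht => by rw [hgg t ht]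
    refine ⟨h0, fun t ht => ?_, ih hw.2.2 hw1 hg1 fun t ht x => ?_⟩
    · rw [hww t ht, hgg t ht]; exact hw.2.1 t ht
    · rw [hg1 t ht]
      exact (hw.2.2.hasDerivWithinAt ht x).congr (fun s hs => by rw [hw1 s hs])
        (by rw [hw1 t ht])

theorem sub {j : ℕ} {w w' g g' : ℝ → ℝ → ℝ} (hw : MixedDeriv h j w g)
    (hw' : MixedDeriv h j w' g') :
    MixedDeriv h j (fun t x => w t x - w' t x) (fun t x => g t x - g' t x) := by
  induction j generalizing w w' g g' with
  | zero => exact fun t ht x => (hw t ht x).sub (hw' t ht x)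
  | succ j ih =>
    refine ⟨fun t ht x => (hw.1 t ht x).sub (hw'.1 t ht x), fun t ht =>
      ⟨(hw.2.1 t ht).1.sub (hw'.2.1 t ht).1, (hw.2.1 t ht).2.sub (hw'.2.1 t ht).2⟩, ?_⟩
    refine (ih hw.2.2 hw'.2.2).congr (fun t ht => ?_) (fun t ht => ?_) <;> funext x
    · exact deriv_fun_sub ((hw.2.1 t ht).1 x) ((hw'.2.1 t ht).1 x)
    · exact deriv_fun_sub ((hw.2.1 t ht).2 x) ((hw'.2.1 t ht).2 x)

theorem separated {κ : Type*} {η : κ → ℝ} {j m : ℕ} {a : κ → ℝ → ℝ} (ha : SmoothBigO η m j a)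
    (k : κ) {φ φ' : ℝ → ℝ} (hφ : ∀ t, HasDerivAt φ (φ' t) t) :
    MixedDeriv h j (fun t x => φ t * a k x) (fun t x => φ' t * a k x) := by
  have h0 : ∀ {a : κ → ℝ → ℝ}, ∀ t ∈ Set.Icc 0 h, ∀ x,
      HasDerivWithinAt (fun s => φ s * a k x) (φ' t * a k x) (Set.Icc 0 h) t :=
    fun t _ x => ((hφ t).mul_const _).hasDerivWithinAt
  induction j generalizing a with
  | zero => exact h0
  | succ j ih =>
    refine ⟨h0, fun t _ => ⟨(ha.differentiable k).const_mul _,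
      (ha.differentiable k).const_mul _⟩, (ih ha.deriv).congr (fun t _ => ?_) (fun t _ => ?_)⟩ <;>
    funext x <;> exact deriv_const_mul _ (ha.differentiable k x)

/-- Partial derivatives of smooth functions commute. -/
theorem of_contDiff {j : ℕ} {w : ℝ × ℝ → ℝ} (hw : ContDiff ℝ (j + 1) w) :
    MixedDeriv h j (fun t x => w (t, x)) (fun t x => fderiv ℝ w (t, x) (1, 0)) := by
  have ht : ∀ {w : ℝ × ℝ → ℝ}, Differentiable ℝ w → ∀ t ∈ Set.Icc 0 h, ∀ x,
      HasDerivWithinAt (fun s => w (s, x)) (fderiv ℝ w (t, x) (1, 0)) (Set.Icc 0 h) t := by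
    intro w hw t _ x
    have h1 : HasDerivAt (fun s : ℝ => (s, x)) ((1 : ℝ), (0 : ℝ)) t :=
      (hasDerivAt_id t).prodMk (hasDerivAt_const t x)
    exact ((hw (t, x)).hasFDerivAt.comp_hasDerivAt t h1).hasDerivWithinAt
  have hx : ∀ {w : ℝ × ℝ → ℝ}, Differentiable ℝ w → ∀ t x,
      HasDerivAt (fun x => w (t, x)) (fderiv ℝ w (t, x) (0, 1)) x := by
    intro w hw t x
    have h1 : HasDerivAt (fun x : ℝ => (t, x)) ((0 : ℝ), (1 : ℝ)) x :=
      (hasDerivAt_const x t).prodMk (hasDerivAt_id x)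
    exact (hw (t, x)).hasFDerivAt.comp_hasDerivAt x h1
  induction j generalizing w with
  | zero => exact ht (hw.differentiable (by simp))
  | succ j ih =>
    have hd : Differentiable ℝ w := hw.differentiable (by simp)
    have hf : ContDiff ℝ (j + 1) (fderiv ℝ w) := hw.fderiv_right (by simp)
    have hfd : Differentiable ℝ (fderiv ℝ w) := hf.differentiable (by simp)
    have hft : Differentiable ℝ (fun z => fderiv ℝ w z (1, 0)) := fun z =>
      (hfd z).clm_apply (differentiableAt_const _)
    refine ⟨ht hd, fun t _ => ⟨fun x => (hx hd t x).differentiableAt,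
      fun x => (hx hft t x).differentiableAt⟩, ?_⟩
    refine (ih (w := fun z => fderiv ℝ w z (0, 1)) (hf.clm_apply contDiff_const)).congr
      (fun t _ => funext fun x => (hx hd t x).deriv) (fun t _ => funext fun x => ?_)
    rw [(hx hft t x).deriv]
    have hsymm := (hw.contDiffAt (x := (t, x))).isSymmSndFDerivAt
      (by simp only [minSmoothness_of_isRCLikeNormedField]; norm_cast; omega)
    rw [fderiv_clm_apply (hfd _) (differentiableAt_const _),
      fderiv_clm_apply (hfd _) (differentiableAt_const _)]
    simpa using hsymm.eq (0, 1) (1, 0)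

end MixedDeriv

/-! ### Exact Euler solutions as an integration rule -/

section

variable {ι : Type*} {h : ι → ℝ}

/-- The time points of the steps. -/
abbrev StepTime (h : ι → ℝ) := {z : ι × ℝ // z.2 ∈ Set.Icc 0 (h z.1)}

/-- Mean value inequality in time; the extra power of `h` is the length of the interval. -/
theorem bound_of_hasDerivWithinAt {m : ℕ} {w g : ι → ℝ → ℝ → ℝ}
    (hw : ∀ i, ∀ t ∈ Set.Icc 0 (h i), ∀ x,
      HasDerivWithinAt (fun s => w i s x) (g i t x) (Set.Icc 0 (h i)) t)
    (h0 : ∀ i x, w i 0 x = 0)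
    (hg : ∃ C, ∀ (z : StepTime h) x, |g z.1.1 z.1.2 x| ≤ C * h z.1.1 ^ m) :
    ∃ C, ∀ (z : StepTime h) x, |w z.1.1 z.1.2 x| ≤ C * h z.1.1 ^ (m + 1) := by
  obtain ⟨C, hC⟩ := hg
  refine ⟨C, ?_⟩
  rintro ⟨⟨i, t⟩, ht⟩ x
  have h1 := norm_image_sub_le_of_norm_deriv_le_segment' (f := fun s => w i s x)
    (f' := fun s => g i s x) (a := 0) (b := h i) (C := C * h i ^ m)
    (fun s hs => hw i s hs x)
    (fun s hs => hC ⟨⟨i, s⟩, Set.Ico_subset_Icc_self hs⟩ x) t ht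
  simp only [h0, sub_zero, Real.norm_eq_abs] at h1
  refine h1.trans ?_
  have h2 : 0 ≤ C * h i ^ m := (abs_nonneg _).trans (hC ⟨⟨i, t⟩, ht⟩ x)
  calc C * h i ^ m * t ≤ C * h i ^ m * h i := mul_le_mul_of_nonneg_left ht.2 h2
    _ = _ := by ring

/-- Space derivatives of `w` also vanish at time `0` and have those of `g` as time derivatives, so
the mean value bound applies at every level. -/
theorem smoothBigO_of_mixedDeriv {m j : ℕ} {w g : ι → ℝ → ℝ → ℝ}
    (hw : ∀ i, MixedDeriv (h i) j (w i) (g i)) (h0 : ∀ i x, w i 0 x = 0)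
    (hg : SmoothBigO (fun z : StepTime h => h z.1.1) m j (fun z => g z.1.1 z.1.2)) :
    SmoothBigO (fun z : StepTime h => h z.1.1) (m + 1) j (fun z => w z.1.1 z.1.2) := by
  have hb := bound_of_hasDerivWithinAt (fun i t ht => (hw i).hasDerivWithinAt ht) h0 hg.bound
  induction j generalizing w g with
  | zero => exact hb
  | succ j ih =>
    have h0' : ∀ i x, deriv (w i 0) x = 0 := fun i x => by
      rw [show w i 0 = fun _ => 0 from funext (h0 i)]; simp
    exact ⟨hb, fun z => ((hw z.1.1).2.1 _ z.2).1, ih (fun i => (hw i).2.2) h0' hg.deriv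
      (bound_of_hasDerivWithinAt (fun i t ht => (hw i).2.2.hasDerivWithinAt ht) h0'
        hg.deriv.bound)⟩

theorem differentiable_eulerFlux {U : ℝ → State} (hU : Differentiable ℝ U)
    (hadm : ∀ x, U x ∈ admissible) : Differentiable ℝ (fun x => eulerFlux (U x)) := by
  have hc : ∀ i, Differentiable ℝ (fun x => U x i) := differentiable_pi.1 hU
  have h0 : ∀ x, U x 0 ≠ 0 := fun x => (hadm x).1.ne'
  have hi : Differentiable ℝ (fun x => (U x 0)⁻¹) := (hc 0).inv h0
  rw [funext fun x => eulerFlux_eq (hadm x)]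
  refine differentiable_pi.2 fun i => ?_
  fin_cases i
  · exact hc 1
  · exact (hc 2).const_mul 2
  · exact ((((hc 1).const_mul 3).mul (hc 2)).mul hi).sub (((hc 1).pow 3).mul (hi.pow 2))

/-- With `θ = t / h` the rule is integration from `0` to `θ`, which maps `1, θ, θ²/2, θ²` to `θ,
θ²/2, θ³/6, θ³/3`. The error vanishes at `t = 0`, and by the Euler equations its time derivative is
minus the space derivative of the flux remainder, so differentiation in time replaces integrals. -/
theorem integrates_exact (hh : ∀ i, 0 < h i) (n : ℕ) {W : ι → ℝ → ℝ → State}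
    {K : ℝ} (hW : ∀ i, IsSmoothEulerSolution (n + 1) K (h i) (W i))
    (hW₀ : ∀ i, SmoothBigO (fun z : StepTime h => h z.1.1) 0 (n + 1) (fun z x => W z.1.1 0 x i))
    (hadm : ∀ i, ∀ t ∈ Set.Icc 0 (h i), ∀ x, W i t x ∈ admissible) :
    Integrates n (fun z : StepTime h => z.1.1) h (fun z => z.1.2 / h z.1.1)
      (fun z => (z.1.2 / h z.1.1) ^ 2 / 2) (fun z => (z.1.2 / h z.1.1) ^ 3 / 6)
      (fun z => (z.1.2 / h z.1.1) ^ 3 / 3) (fun z => W z.1.1 z.1.2) (fun i => W i 0) := by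
  intro m j G i hj hF
  have hG := hF.smooth
  have hFd : ∀ a, ∀ t ∈ Set.Icc 0 (h a), Differentiable ℝ (fun x => eulerFlux (W a t x)) :=
    fun a t ht => differentiable_eulerFlux
      (((hW a).smooth t ht).contDiff.differentiable (by simp)) (hadm a t ht)
  have key : ∀ a, MixedDeriv (h a) j
      (fun t x => W a t x i - (W a 0 x i - (t * deriv (G a).z₀ x + t ^ 2 / 2 * deriv (G a).z₁ x +
        t ^ 3 / 6 * deriv (G a).z₂ x + t ^ 3 / 3 * deriv (G a).z₃ x)))
      (fun t x => -(deriv (fun y => eulerFlux (W a t y)) x i - (deriv (G a).z₀ x +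
        t * deriv (G a).z₁ x + t ^ 2 / 2 * deriv (G a).z₂ x + t ^ 2 * deriv (G a).z₃ x))) := by
    intro a
    have hc : ContDiff ℝ (j + 1) (fun z : ℝ × ℝ => W a z.1 z.2 i) :=
      (contDiff_pi.1 (hW a).contDiff i).of_le (by norm_cast; omega)
    have m0 := MixedDeriv.of_contDiff (h := h a) hc
    have m1 : MixedDeriv (h a) j (fun t x => W a t x i)
        (fun t x => -deriv (fun y => eulerFlux (W a t y)) x i) := by
      refine m0.congr (fun t _ => rfl) fun t ht => funext fun x => ?_
      have e1 := (hasDerivAt_pi.1 ((hW a).euler t ht x)) i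
      have e2 := m0.hasDerivWithinAt ht x
      exact (uniqueDiffOn_Icc (hh a) t ht).eq_deriv _ e1.hasDerivWithinAt e2
    -- The coefficients do not depend on time, so their regularity may be read off at time `0`.
    let k : StepTime h := ⟨(a, 0), Set.left_mem_Icc.2 (hh a).le⟩
    have p := MixedDeriv.separated (h := h a) (hW₀ i |>.of_order_le (by omega : j ≤ n + 1)) k
      (fun t => hasDerivAt_const t (1 : ℝ))
    have p0 := MixedDeriv.separated (h := h a) hG.z₀.deriv k (fun t => (hasDerivAt_id t).neg)
    have p1 := MixedDeriv.separated (h := h a) hG.z₁.deriv k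
      (φ' := fun t => -t) (fun t => (((hasDerivAt_id t).pow 2).div_const 2).neg.congr_deriv
        (by simp))
    have p2 := MixedDeriv.separated (h := h a) hG.z₂.deriv k
      (φ' := fun t => -(t ^ 2 / 2)) (fun t => (((hasDerivAt_id t).pow 3).div_const 6).neg.congr_deriv
        (by simp; ring))
    have p3 := MixedDeriv.separated (h := h a) hG.z₃.deriv k
      (φ' := fun t => -t ^ 2) (fun t => (((hasDerivAt_id t).pow 3).div_const 3).neg.congr_deriv
        (by simp))
    refine (((((m1.sub p).sub p0).sub p1).sub p2).sub p3).congr (fun t _ => ?_) (fun t _ => ?_) <;>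
      funext x <;> simp [k] <;> ring
  have hg := hF.remainder.deriv.const_mul (-1)
  refine (smoothBigO_of_mixedDeriv key (fun a x => by simp) (hg.congr ?_)).congr ?_
  · rintro ⟨⟨a, t⟩, ht⟩ x
    have hG0 := (hG.z₀.differentiable ⟨⟨a, t⟩, ht⟩) x
    have hG1 := (hG.z₁.differentiable ⟨⟨a, t⟩, ht⟩) x
    have hG2 := (hG.z₂.differentiable ⟨⟨a, t⟩, ht⟩) x
    have hG3 := (hG.z₃.differentiable ⟨⟨a, t⟩, ht⟩) x
    have hFx := hFd a t ht x
    have e : deriv (fun x => eulerFlux (W a t x) i -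
        (G a).val (t / h a) ((t / h a) ^ 2 / 2) (h a) x) x =
        deriv (fun y => eulerFlux (W a t y)) x i -
          deriv ((G a).val (t / h a) ((t / h a) ^ 2 / 2) (h a)) x := by
      rw [deriv_component hFx]
      exact deriv_fun_sub (hasDerivAt_pi.1 hFx.hasDerivAt i).differentiableAt
        (((hG0.add (hG1.const_mul _)).add (hG2.const_mul _)).add (hG3.const_mul _))
    have hne := (hh a).ne'
    dsimp only at hG0 hG1 hG2 hG3 ⊢
    rw [e, deriv_jet_val hG0 hG1 hG2 hG3]
    field_simp
  · rintro ⟨⟨a, t⟩, ht⟩ x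
    have hne := (hh a).ne'
    simp only [integratedVal]
    field_simp

end

section

/-! ### The local error of the limit scheme -/

/-- One step of the limit scheme together with the exact solution that starts from the same data. -/
structure StepData {r : ℕ} (T : ButcherTableau r) (p : ℕ) (τ K : ℝ) where
  h : ℝ
  h_mem : h ∈ Set.Ioc 0 τ
  U : Fin (r + 1) → ℝ → State
  W : ℝ → ℝ → State
  smooth : ∀ k, SmoothState (p + 1) K (U k)
  solution : IsSmoothEulerSolution (p + 1) K h W
  differentiable : ∀ k, Differentiable ℝ (fun x => eulerFlux (U k x))
  scheme : ∀ k x, U k x = W 0 x -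
    h • ∑ l ∈ Finset.Iic k, T.A k l • deriv (fun y => eulerFlux (U l y)) x

theorem SmoothState.admissible {m : ℕ} {K : ℝ} (hK : 0 < K) {U : ℝ → State}
    (hU : SmoothState m K U) (x : ℝ) : U x ∈ LowRankBGK.admissible :=
  boundedStates_subset (inv_pos.2 hK) (inv_pos.2 hK)
    (⟨hU.density_ge x, hU.temperature_ge x, by simpa using hU.bound 0 (Nat.zero_le _) x⟩ :
      U x ∈ boundedStates K⁻¹ K⁻¹ K)

theorem exists_abs_le {α : Type*} [Finite α] (f : α → ℝ) : ∃ D, ∀ k, |f k| ≤ D :=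
  (Set.finite_range fun k => |f k|).bddAbove.imp fun _ hD k => hD ⟨k, rfl⟩

variable {r : ℕ} {T : ButcherTableau r} {p : ℕ}

/-- The coefficients of the elementary differentials in the local error are of order `h^(p+1)`. -/
theorem order_defect {α : Type*} {h : α → ℝ} {τ : ℝ} (hh : ∀ i, 0 ≤ h i ∧ h i ≤ τ) {n : ℕ} {a b : ℝ}
    (hab : n ≤ p → a = b) : ∃ D, ∀ i, |h i ^ n * (a - b)| ≤ D * h i ^ (p + 1) := by
  by_cases hn : n ≤ p
  · exact ⟨0, fun i => by simp [hab hn]⟩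
  · refine ⟨τ ^ (n - (p + 1)) * |a - b|, fun i => ?_⟩
    have h0 := (hh i).1
    rw [abs_mul, abs_of_nonneg (pow_nonneg h0 n)]
    calc h i ^ n * |a - b| = h i ^ (n - (p + 1)) * |a - b| * h i ^ (p + 1) := by
          rw [mul_right_comm, ← pow_add, Nat.sub_add_cancel (by omega)]
      _ ≤ _ := by
          gcongr
          exact (hh i).2

/-- Both expansions use the same jet of the initial data, so their difference consists of the
remainders and of `h^n` times differences of quadrature coefficients. The index set is the type of
all `StepData`, so the constant of the family is uniform over all steps. -/
theorem local_error (hT : T.IsStifflyAccurateDIRK) (hp : 1 ≤ p) (hord : T.HasOrder p)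
    (τ : ℝ) {K : ℝ} (hK : 0 < K) :
    ∃ C, ∀ (S : StepData T p τ K) x,
      ‖S.U (Fin.last r) x - S.W S.h x‖ ≤ C * S.h ^ (p + 1) := by
  set H : StepData T p τ K → ℝ := fun S => S.h with hH
  have hh : ∀ S, 0 ≤ H S ∧ H S ≤ τ := fun S => ⟨S.h_mem.1.le, S.h_mem.2⟩
  have hδ : 0 < K⁻¹ := inv_pos.2 hK
  have hW0 : ∀ S : StepData T p τ K, SmoothState (p + 1) K (S.W 0) := fun S =>
    S.solution.smooth 0 (Set.left_mem_Icc.2 S.h_mem.1.le)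
  obtain ⟨D₁, hD₁⟩ := exists_abs_le T.c
  obtain ⟨D₂, hD₂⟩ := exists_abs_le fun k => ∑ l, T.A k l * T.c l
  obtain ⟨D₃, hD₃⟩ := exists_abs_le fun k => ∑ l, T.A k l * ∑ m, T.A l m * T.c m
  obtain ⟨D₄, hD₄⟩ := exists_abs_le fun k => ∑ l, T.A k l * T.c l ^ 2
  have e₁ := (integrates_stages (h := H) (U := fun S => S.U) (U₀ := fun S => S.W 0) hT
    (fun S => (hh S).1) p (fun S => S.differentiable) (fun S => S.scheme)).expansion
    (D := max (max D₁ D₂) (max D₃ D₄)) (δ := K⁻¹) hord.le_three hh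
    (fun k => (hD₁ _).trans (by simp)) (fun k => (hD₂ _).trans (by simp))
    (fun k => (hD₃ _).trans (by simp)) (fun k => (hD₄ _).trans (by simp))
    (SmoothState.smoothBigO fun k => k.1.smooth k.2) (SmoothState.smoothBigO fun k => hW0 k.1)
    (fun k => (k.1.smooth k.2).admissible hK) hδ (fun k => (k.1.smooth k.2).density_ge)
    (fun S => (hW0 S).density_ge)
  have hθ : ∀ z : StepTime H, 0 ≤ z.1.2 / H z.1.1 ∧ z.1.2 / H z.1.1 ≤ 1 := fun z =>
    ⟨div_nonneg z.2.1 (hh _).1, div_le_one_of_le₀ z.2.2 (hh _).1⟩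
  have hpow : ∀ (z : StepTime H) (n : ℕ) (a : ℝ), 1 ≤ a → |(z.1.2 / H z.1.1) ^ n / a| ≤ 1 := by
    intro z n a ha
    obtain ⟨h0, h1⟩ := hθ z
    rw [abs_of_nonneg (by positivity)]
    exact div_le_one_of_le₀ ((pow_le_one₀ h0 h1).trans ha) (by positivity)
  have e₂ := (integrates_exact (h := H) (fun S => S.h_mem.1) p (W := fun S => S.W)
    (fun S => S.solution) (SmoothState.smoothBigO fun z => hW0 z.1.1)
    (fun S t ht => (S.solution.smooth t ht).admissible hK)).expansion (D := 1) (δ := K⁻¹)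
    hord.le_three hh (fun z => by simpa using hpow z 1 1 le_rfl)
    (fun z => hpow z 2 2 (by norm_num)) (fun z => hpow z 3 6 (by norm_num))
    (fun z => hpow z 3 3 (by norm_num))
    (SmoothState.smoothBigO fun z => z.1.1.solution.smooth z.1.2 z.2)
    (SmoothState.smoothBigO fun z => hW0 z.1.1)
    (fun z => (z.1.1.solution.smooth z.1.2 z.2).admissible hK) hδ
    (fun z => (z.1.1.solution.smooth z.1.2 z.2).density_ge) (fun S => (hW0 S).density_ge)
  -- Stiff accuracy makes the last row of `A` equal to `b`, so the order conditions become
  -- statements about the last stage.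
  have hc : T.c (Fin.last r) = 1 := by
    rw [hT.row_sum, ← hord.first hp]; simp [hT.stiffly_accurate]
  obtain ⟨C₂, hC₂⟩ := order_defect (p := p) hh (n := 2)
    (a := ∑ l, T.A (Fin.last r) l * T.c l) (b := 1 / 2) fun h => by
      rw [← hord.second h]; simp [hT.stiffly_accurate]
  obtain ⟨C₃, hC₃⟩ := order_defect (p := p) hh (n := 3)
    (a := ∑ l, T.A (Fin.last r) l * ∑ m, T.A l m * T.c m) (b := 1 / 6) fun h => by
      rw [← (hord.third h).2]; simp [hT.stiffly_accurate, Finset.mul_sum, mul_assoc]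
  obtain ⟨C₄, hC₄⟩ := order_defect (p := p) hh (n := 3)
    (a := ∑ l, T.A (Fin.last r) l * T.c l ^ 2) (b := 1 / 3) fun h => by
      rw [← (hord.third h).1]; simp [hT.stiffly_accurate]
  have comp : ∀ i, ∃ C, ∀ (S : StepData T p τ K) x,
      |S.U (Fin.last r) x i - S.W S.h x i| ≤ C * S.h ^ (p + 1) := by
    intro i
    obtain ⟨hJ, C₅, hC₅⟩ := e₁ i
    obtain ⟨-, C₆, hC₆⟩ := e₂ i
    -- The two families are specialised to the last stage and to the final time `t = h`, where the
    -- exact coefficients are `1, 1/2, 1/6, 1/3`.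
    have r₁ : SmoothBigO H (p + 1) 0 _ :=
      SmoothBigO.comp (fun S : StepData T p τ K => (S, Fin.last r)) (j := 0) ⟨C₅, hC₅⟩
    have r₂ : SmoothBigO H (p + 1) 0 _ := SmoothBigO.comp
      (fun S : StepData T p τ K => (⟨(S, S.h), Set.right_mem_Icc.2 S.h_mem.1.le⟩ : StepTime H))
      (j := 0) ⟨C₆, hC₆⟩
    have t₂ := (hJ.z₁.deriv.comp (fun S : StepData T p τ K => (S, Fin.last r))).smul hC₂
    have t₃ := (hJ.z₂.deriv.comp (fun S : StepData T p τ K => (S, Fin.last r))).smul hC₃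
    have t₄ := (hJ.z₃.deriv.comp (fun S : StepData T p τ K => (S, Fin.last r))).smul hC₄
    rw [zero_add] at t₂ t₃ t₄
    have := ((((r₁.sub r₂).sub t₂).sub t₃).sub t₄)
    refine SmoothBigO.bound (this.congr (b := fun S x => S.U (Fin.last r) x i - S.W S.h x i)
      fun S x => ?_)
    have h1 : S.h / S.h = 1 := div_self S.h_mem.1.ne'
    simp only [integratedVal, hc, hH, h1]
    ring
  choose C hC using comp
  refine ⟨∑ i, |C i|, fun S x => ?_⟩
  have hpos : 0 ≤ S.h ^ (p + 1) := pow_nonneg S.h_mem.1.le _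
  refine (pi_norm_le_iff_of_nonneg (by positivity)).2 fun i => (hC i S x).trans ?_
  gcongr
  exact (le_abs_self _).trans (Finset.single_le_sum (f := fun i => |C i|)
    (fun i _ => abs_nonneg _) (Finset.mem_univ i))

/-! ### Asymptotic accuracy -/

/-- Since `h` is fixed while `ε` tends to `0`, the distance to the limit eventually drops below
`h^(p+1)`, and only the local error of the limit scheme remains. -/
theorem order_of_accuracy (hT : T.IsStifflyAccurateDIRK) (hp : 1 ≤ p) (hord : T.HasOrder p)
    (q : ℕ) (τ : ℝ) {K : ℝ} (hK : 0 < K) : ∃ C, ∀ (S : StepData T p τ K) (L : Filter ℝ)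
      (F : ℝ → Field) (V : ℝ → ℝ → State),
      TendstoUniformly V (S.U (Fin.last r)) L →
      Tendsto (fun ε => wnorm q (fun x v =>
        F ε x v - localMaxwellian (S.U (Fin.last r)) x v)) L (𝓝 0) →
      ∀ᶠ ε in L, (∀ x, ‖V ε x - S.W S.h x‖ ≤ C * S.h ^ (p + 1)) ∧
        wnorm q (fun x v => F ε x v - localMaxwellian (S.W S.h) x v) ≤
          ENNReal.ofReal (C * S.h ^ (p + 1)) := by
  obtain ⟨C, hC⟩ := local_error hT hp hord τ hK
  have hKi : 0 < K⁻¹ := inv_pos.2 hK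
  obtain ⟨M, hM0, -, hM⟩ := exists_maxwellian_bounds (isCompact_boundedStates hKi K⁻¹ K)
    (boundedStates_subset hKi hKi) q
  -- `|C|` covers the macroscopic local error, `M * |C|` its image under the Lipschitz map to
  -- Maxwellians, and `1` the distance to the limit.
  refine ⟨(M + 1) * |C| + 1, fun S L F V hV hF => ?_⟩
  have hpos : 0 < S.h ^ (p + 1) := pow_pos S.h_mem.1 _
  have hmem : ∀ {U : ℝ → State}, SmoothState (p + 1) K U → ∀ x, U x ∈ boundedStates K⁻¹ K⁻¹ K :=
    fun hU x => ⟨hU.density_ge x, hU.temperature_ge x, by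
      simpa using hU.bound 0 (Nat.zero_le _) x⟩
  have h1 := Metric.tendstoUniformly_iff.1 hV _ hpos
  have h2 := ENNReal.tendsto_nhds_zero.1 hF _ (ENNReal.ofReal_pos.2 hpos)
  have hC' : ∀ x, ‖S.U (Fin.last r) x - S.W S.h x‖ ≤ |C| * S.h ^ (p + 1) := fun x =>
    (hC S x).trans (by gcongr; exact le_abs_self C)
  have hnn : 0 ≤ |C| * S.h ^ (p + 1) := by positivity
  filter_upwards [h1, h2] with ε h3 h4
  refine ⟨fun x => ?_, wnorm_le_ofReal fun x v => ?_⟩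
  · have h5 := h3 x
    rw [dist_comm, dist_eq_norm] at h5
    have h6 := norm_sub_le_norm_sub_add_norm_sub (V ε x) (S.U (Fin.last r) x) (S.W S.h x)
    have h7 := hC' x
    nlinarith [mul_nonneg hM0 hnn]
  · have h5 := le_of_wnorm_le h4 x v
    rw [max_eq_left hpos.le] at h5
    have h6 := hM _ (hmem (S.smooth (Fin.last r)) x) _
      (hmem (S.solution.smooth S.h (Set.right_mem_Icc.2 S.h_mem.1.le)) x) v
    have h7 := mul_le_mul_of_nonneg_left (hC' x) hM0
    have h8 : (1 + |v|) ^ q * |F ε x v - localMaxwellian (S.W S.h) x v| ≤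
        (1 + |v|) ^ q * |F ε x v - localMaxwellian (S.U (Fin.last r)) x v| +
        (1 + |v|) ^ q * |maxwellian (S.U (Fin.last r) x) v - maxwellian (S.W S.h x) v| := by
      rw [← mul_add]
      gcongr
      exact abs_sub_le _ _ _
    nlinarith

end

end LowRankBGK

end

/-! ### The main theorem -/

open LowRankBGK in
theorem mainTheorem3 (r : ℕ) (T : ButcherTableau r) (hT : T.IsStifflyAccurateDIRK)
    (p : ℕ) (hp : 1 ≤ p) (hord : T.HasOrder p) (q : ℕ) (hq : 5 ≤ q)
    (f : ℝ → Field) (hf_meas : ∀ ε > 0, Measurable (Function.uncurry (f ε)))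
    (hf : WellPrepared q f)
    (τ : ℝ) (N : ℝ → ℕ) (P : ℝ → ℝ → Compression) (R : ℝ → ℝ → Trajectory r)
    (hrun : ∀ Δt ∈ Set.Ioc 0 τ, ∀ᶠ ε in 𝓝[>] (0 : ℝ),
      (R Δt ε).IsRun T (P Δt ε) Δt ε (N Δt) (f ε))
    (hkin : ∀ Δt ∈ Set.Ioc 0 τ, ∀ n < N Δt, ∀ k,
      NonDegenerate (fun ε => moments ((R Δt ε).fullSL T Δt ε n k)))
    (hmac : ∀ Δt ∈ Set.Ioc 0 τ, ∀ n < N Δt, ∀ k,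
      NonDegenerate (fun ε => (R Δt ε).stageMac n k) ∧
      UniformlyBounded (fun ε => (R Δt ε).stageMac n k))
    (htrunc : ∀ Δt ∈ Set.Ioc 0 τ, ∀ n < N Δt, ∀ k, ∃ C : ℝ, ∀ᶠ ε in 𝓝[>] (0 : ℝ),
      wnorm q ((R Δt ε).errSVD n k) + wnorm q ((R Δt ε).errCUR T Δt ε n k) ≤
        ENNReal.ofReal (C * ε)) :
    IsAsymptoticallyAccurate q T p τ N R := by
  have runs : ∀ Δt ∈ Set.Ioc 0 τ, AdmissibleRuns q T (P Δt) Δt (N Δt) f (R Δt) := fun Δt hΔt =>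
    { pos := hΔt.1
      tableau := hT
      weight := hq
      measurable := hf_meas
      bounded := hf.bounded
      run := hrun Δt hΔt
      kinetic := hkin Δt hΔt
      macroscopic := fun n hn k => by
        obtain ⟨h1, K, hK⟩ := hmac Δt hΔt n hn k
        exact h1.uniformlyAdmissible hK
      svd_error := fun n hn k => FieldBigO.of_wnorm <| by
        obtain ⟨C, hC⟩ := htrunc Δt hΔt n hn k
        exact ⟨C, hC.mono fun ε h => le_self_add.trans h⟩
      cur_error := fun n hn k => FieldBigO.of_wnorm <| by
        obtain ⟨C, hC⟩ := htrunc Δt hΔt n hn k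
        exact ⟨C, hC.mono fun ε h => le_add_self.trans h⟩ }
  have limit : ∀ Δt ∈ Set.Ioc 0 τ, ∀ n < N Δt, ∀ (L : Filter ℝ), L.NeBot → L ≤ 𝓝[>] 0 →
      ∀ (U₀ : ℝ → State) (U : Fin (r + 1) → ℝ → State), IsMacroLimit (R Δt) n L U₀ U → ∀ k,
      Tendsto (fun ε => wnorm q (fun x v => (R Δt ε).stageKin n k x v
        - localMaxwellian (U k) x v)) L (𝓝 0) ∧
      Differentiable ℝ (fun x => eulerFlux (U k x)) ∧
      ∀ x, U k x = U₀ x -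
        Δt • ∑ l ∈ Finset.Iic k, T.A k l • deriv (fun y => eulerFlux (U l y)) x := by
    intro Δt hΔt n hn L hL hL0 U₀ U hU k
    have h := runs Δt hΔt
    have h1 := h.limit_scheme hn hL0 hU
    exact ⟨tendsto_wnorm_maxwellian (h.macroscopic n hn k) (h.near_maxwellian hn k) hL0 (hU.2 k),
      h1.1 k, h1.2 k⟩
  refine ⟨fun Δt hΔt n hn k => ?_, fun Δt hΔt n hn k => ?_, limit, fun K hK => ?_⟩
  · have h := runs Δt hΔt
    exact (h.stage_closure hn (h.near_maxwellian hn k)).1.wnorm_le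
  · have h := runs Δt hΔt
    obtain ⟨C, hC⟩ := (h.stage_closure hn (h.near_maxwellian hn k)).2
    exact ⟨C, by simpa using hC⟩
  · obtain ⟨C, hC⟩ := order_of_accuracy hT hp hord q τ hK
    refine ⟨C, fun Δt hΔt n hn L hL hL0 U₀ U hU hs W hW hW0 => ?_⟩
    have hlim := limit Δt hΔt n hn L hL hL0 U₀ U hU
    -- `C` was fixed before `Δt`, the step and the limit; these enter only through this datum, whose
    -- stage equations come from the limit scheme.
    let S : StepData T p τ K :=
      { h := Δt
        h_mem := hΔt
        U := U
        W := W
        smooth := hs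
        solution := hW
        differentiable := fun k => (hlim k).2.1
        scheme := fun k x => by rw [hW0]; exact (hlim k).2.2 x }
    filter_upwards [hC S L (fun ε => (R Δt ε).stageKin n (Fin.last r))
      (fun ε => (R Δt ε).stageMac n (Fin.last r)) (hU.2 _) (hlim _).1,
      (hrun Δt hΔt).filter_mono hL0] with ε h1 h2
    rw [h2.kin_succ n hn, h2.mac_succ n hn]
    exact h1
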